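/- Let $\psi=\Gamma'/\Gamma$ be the digamma function, $G=\sum_{k\ge0}\frac{(-1)^k}{(2k+1)^2}$ Catalan's constant, and $\mathrm{Li}_3$ the principal branch of the trilogarithm, i.e. the analytic continuation of $\sum_{k\ge1}z^k/k^3$ to $\mathbb C\setminus[1,\infty)$. For every integer $n\ge 0$ the series $$\Theta_2(n,0)=\sum_{k=1}^\infty(-1)^k\,\frac{\psi\!\left(\frac{2k+2n+5}{4}\right)-\psi\!\left(\frac{2k+2n+3}{4}\right)}{(2k)^2}$$ converges absolutely, and its value is as follows. (a) If $n=0$: $$-4+\pi+2\ln2-\frac{\pi}{4}\ln^22-\frac{\pi^2}{12}-\frac{5\pi^3}{48}-2G\ln2+4\,\mathrm{Im}\,\mathrm{Li}_3(1+i).$$ (b) If $n=1$: $$\frac{116}{27}-\frac{10\pi}{9}-\frac{16\ln2}{9}+\frac{\pi}{4}\ln^22+\frac{\pi^2}{18}+\frac{5\pi^3}{48}+2G\ln2-4\,\mathrm{Im}\,\mathrm{Li}_3(1+i).$$ (c) If $n$ is odd and $n\ne1$: $$\begin{aligned}&\frac{116}{27}+8\sum_{k=1}^{\frac{n-1}{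2}}\sum_{j=0}^{2k}\frac{(-1)^j(16k^2+16k+5)}{(2j+1)(4k+3)^2(4k+1)^2}-4\sum_{j=1}^{\frac{n-1}{2}}\frac{1}{(4j+3)^3}\\&+\left(-\frac{10}{9}-\sum_{j=1}^{\frac{n-1}{2}}\frac{2(16j^2+16j+5)}{(4j+3)^2(4j+1)^2}+\frac14\ln^22\right)\pi-\left(\frac19+\sum_{j=1}^{\frac{n-1}{2}}\frac{2j+1}{(4j+3)^2(4j+1)^2}\right)16\ln2\\&+\left(\frac1{18}+\frac16\sum_{j=1}^{\frac{n-1}{2}}\frac{1}{(4j+3)(4j+1)}\right)\pi^2+\frac{5\pi^3}{48}+2G\ln2-4\,\mathrm{Im}\,\mathrm{Li}_3(1+i).\end{aligned}$$ (d) If $n$ is even (for $n=0$ the sums below from $0$ to $\frac{n-2}{2}$ are empty): $$\begin{aligned}&-4-8\sum_{k=0}^{\frac{n-2}{2}}\sum_{j=0}^{2k+1}\frac{(-1)^j(16k^2+32k+17)}{(2j+1)(4k+5)^2(4k+3)^2}-4\sum_{j=0}^{\frac{n-2}{2}}\frac{1}{(4j+5)^3}\\&+\left(1+\sum_{j=0}^{\frac{n-2}{2}}\frac{2(16j^2+32j+17)}{(4j+5)^2(4j+3)^2}-\frac14\ln^22\right)\pi+\left(1-16\sum_{j=0}^{\frac{n-2}{2}}\frac{j+1}{(4j+5)^2(4j+3)^2}\right)2\ln2\\&+\left(-\frac12+\sum_{j=0}^{\frac{n-2}{2}}\frac{1}{(4j+5)(4j+3)}\right)\frac{\pi^2}{6}-\frac{5\pi^3}{48}-2G\ln2+4\,\mathrm{Im}\,\mathrm{Li}_3(1+i).\end{aligned}$$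 -/

import Mathlib

open scoped Real

/-- Catalan's constant `G = ∑_{k ≥ 0} (-1)^k / (2k+1)^2`. -/
noncomputable def catalanG : ℝ := ∑' k : ℕ, (-1 : ℝ) ^ k / (2 * (k : ℝ) + 1) ^ 2

/-- The difference `f(k, n) = ψ((2k+2n+5)/4) - ψ((2k+2n+3)/4)` of values of the digamma function
`ψ = Γ'/Γ`. -/
noncomputable def digammaDiff (k n : ℕ) : ℂ :=
  Complex.digamma ((2 * (k : ℂ) + 2 * (n : ℂ) + 5) / 4) -
    Complex.digamma ((2 * (k : ℂ) + 2 * (n : ℂ) + 3) / 4)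

/-- The principal branch of the trilogarithm `Li₃(z)` for `z` outside the cut `(1, ∞)`, through the
integral `Li₃(z) = (z/2) ∫₀¹ log²(t) / (1 - z t) dt`. The next two lemmas show that it is the sum
of `∑_{k ≥ 1} z^k / k^3` for `|z| ≤ 1` and that it is holomorphic on `ℂ ∖ [1, ∞)`; so it is the
analytic continuation of that series. -/
noncomputable def trilog (z : ℂ) : ℂ :=
  z / 2 * ∫ t in (0 : ℝ)..1, ((Real.log t : ℝ) : ℂ) ^ 2 / (1 - z * (t : ℂ))

theorem trilog_moment (k : ℕ) :
    IntervalIntegrable (fun t : ℝ => t ^ k * Real.log t ^ 2) MeasureTheory.volume 0 1 ∧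
      ∫ t in (0 : ℝ)..1, t ^ k * Real.log t ^ 2 = 2 / ((k : ℝ) + 1) ^ 3 := by
  set F : ℝ → ℝ := fun t => t ^ k * (t * Real.log t ^ 2 / (k + 1)
    - 2 * (t * Real.log t) / (k + 1) ^ 2 + 2 * t / (k + 1) ^ 3) with hF
  have hk : (k : ℝ) + 1 ≠ 0 := by positivity
  have h2 : ContinuousOn (fun t : ℝ => t * Real.log t ^ 2) (Set.Icc 0 1) := by
    have hc : Continuous fun t : ℝ => 4 * (√t * Real.log √t) ^ 2 :=
      continuous_const.mul ((Real.continuous_mul_log.comp Real.continuous_sqrt).pow 2)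
    refine hc.continuousOn.congr fun t ht => ?_
    have h : √t ^ 2 = t := Real.sq_sqrt ht.1
    simp only [Real.log_sqrt ht.1, mul_pow, h]
    ring
  have hcont : ContinuousOn F (Set.Icc 0 1) := by
    refine (continuous_pow k).continuousOn.mul (((h2.div_const _).sub ?_).add ?_)
    · exact ((continuous_const.mul Real.continuous_mul_log).div_const _).continuousOn
    · exact ((continuous_const.mul continuous_id).div_const _).continuousOn
  have hderiv : ∀ t ∈ Set.Ioo (0 : ℝ) 1, HasDerivAt F (t ^ k * Real.log t ^ 2) t := by
    intro t ht
    have ht0 : t ≠ 0 := ht.1.ne'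
    have hl := Real.hasDerivAt_log ht0
    have hid := hasDerivAt_id t
    have hp : HasDerivAt (fun t : ℝ => t ^ (k + 1) * (Real.log t ^ 2 / (k + 1)
        - 2 * Real.log t / (k + 1) ^ 2 + 2 / (k + 1) ^ 3)) (t ^ k * Real.log t ^ 2) t := by
      have := (hasDerivAt_pow (k + 1) t).mul ((((hl.pow 2).div_const ((k : ℝ) + 1)).sub
        ((hl.const_mul 2).div_const (((k : ℝ) + 1) ^ 2))).add_const (2 / ((k : ℝ) + 1) ^ 3))
      refine this.congr_deriv ?_
      simp only [Nat.add_sub_cancel, Nat.cast_add, Nat.cast_one, pow_succ, Pi.pow_apply,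
        Pi.sub_apply]
      field_simp
      push_cast
      ring
    refine hp.congr_of_eventuallyEq (Filter.Eventually.of_forall fun s => ?_)
    simp only [hF]
    ring
  have hint : IntervalIntegrable (fun t : ℝ => t ^ k * Real.log t ^ 2)
      MeasureTheory.volume 0 1 := by
    refine intervalIntegral.intervalIntegrable_deriv_of_nonneg (g := F) ?_ ?_ ?_
    · rwa [Set.uIcc_of_le zero_le_one]
    · simpa using hderiv
    · intro t ht
      have : 0 < t := by simpa using ht.1
      positivity
  refine ⟨hint, ?_⟩
  rw [intervalIntegral.integral_eq_sub_of_hasDerivAt_of_le zero_le_one hcont hderiv hint]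
  simp [hF]

theorem hasSum_trilog {z : ℂ} (hz : ‖z‖ ≤ 1) :
    HasSum (fun k : ℕ => z ^ (k + 1) / ((k : ℂ) + 1) ^ 3) (trilog z) := by
  set g : ℕ → ℝ → ℂ := fun k t => z ^ k * ((t ^ k * Real.log t ^ 2 : ℝ) : ℂ) with hg
  have hgi : ∀ k, MeasureTheory.Integrable (g k)
      (MeasureTheory.volume.restrict (Set.Ioc (0 : ℝ) 1)) := fun k =>
    (((intervalIntegrable_iff_integrableOn_Ioc_of_le zero_le_one).1
      (trilog_moment k).1).ofReal).const_mul _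
  have hnorm : ∀ k, ∫ t in Set.Ioc (0 : ℝ) 1, ‖g k t‖ ≤ 2 / ((k : ℝ) + 1) ^ 3 := by
    intro k
    rw [← (trilog_moment k).2, intervalIntegral.integral_of_le zero_le_one]
    refine MeasureTheory.setIntegral_mono_on (hgi k).norm
      ((intervalIntegrable_iff_integrableOn_Ioc_of_le zero_le_one).1 (trilog_moment k).1)
      measurableSet_Ioc fun t ht => ?_
    have h0 : 0 ≤ t ^ k * Real.log t ^ 2 := mul_nonneg (pow_nonneg ht.1.le _) (sq_nonneg _)
    simp only [hg]
    rw [norm_mul, norm_pow, Complex.norm_real, Real.norm_of_nonneg h0]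
    exact mul_le_of_le_one_left h0 (pow_le_one₀ (norm_nonneg _) hz)
  have hsum : Summable fun k => ∫ t in Set.Ioc (0 : ℝ) 1, ‖g k t‖ := by
    refine Summable.of_nonneg_of_le (fun k => by positivity) hnorm ?_
    have h := (summable_nat_add_iff 1).2 (Real.summable_one_div_nat_pow.2 (by norm_num : 1 < 3))
    simpa [div_eq_mul_inv] using h.mul_left 2
  have key := (MeasureTheory.hasSum_integral_of_summable_integral_norm hgi hsum).mul_left (z / 2)
  have hrhs : ∫ t in Set.Ioc (0 : ℝ) 1, ∑' k, g k t
      = ∫ t in (0 : ℝ)..1, ((Real.log t : ℝ) : ℂ) ^ 2 / (1 - z * (t : ℂ)) := by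
    rw [intervalIntegral.integral_of_le zero_le_one, MeasureTheory.integral_Ioc_eq_integral_Ioo,
      MeasureTheory.integral_Ioc_eq_integral_Ioo]
    refine MeasureTheory.setIntegral_congr_fun measurableSet_Ioo fun t ht => ?_
    have hlt : ‖z * (t : ℂ)‖ < 1 := by
      rw [norm_mul, Complex.norm_real, Real.norm_of_nonneg ht.1.le]
      exact (mul_le_of_le_one_left ht.1.le hz).trans_lt ht.2
    have := ((hasSum_geometric_of_norm_lt_one hlt).mul_left (((Real.log t : ℝ) : ℂ) ^ 2)).tsum_eq
    simp only [div_eq_mul_inv]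
    rw [← this]
    refine tsum_congr fun k => ?_
    simp only [hg]
    push_cast
    ring
  rw [hrhs] at key
  refine key.congr_fun fun k => ?_
  simp only [hg]
  rw [MeasureTheory.integral_const_mul, integral_complex_ofReal,
    ← intervalIntegral.integral_of_le zero_le_one, (trilog_moment k).2]
  push_cast
  field_simp
  ring

theorem differentiableOn_trilog :
    DifferentiableOn ℂ trilog {z : ℂ | ∀ x : ℝ, 1 ≤ x → z ≠ (x : ℂ)} := by
  intro z hz
  have hne : ∀ t ∈ Set.Icc (0 : ℝ) 1, 1 - z * (t : ℂ) ≠ 0 := by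
    intro t ht h
    have h1 : z * (t : ℂ) = 1 := (sub_eq_zero.1 h).symm
    have ht0 : (t : ℂ) ≠ 0 := right_ne_zero_of_mul_eq_one h1
    have htpos : 0 < t := lt_of_le_of_ne ht.1 fun h0 => ht0 (by simp [← h0])
    refine hz t⁻¹ ((one_le_inv₀ htpos).2 ht.2) ?_
    rw [Complex.ofReal_inv]
    exact eq_inv_of_mul_eq_one_left h1
  obtain ⟨t₀, ht₀, hmin⟩ := isCompact_Icc.exists_isMinOn
    (Set.nonempty_Icc.2 (zero_le_one (α := ℝ)))
    (f := fun t : ℝ => ‖1 - z * (t : ℂ)‖) (by fun_prop)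
  set m := ‖1 - z * (t₀ : ℂ)‖ with hm
  have hm0 : 0 < m := norm_pos_iff.2 (hne t₀ ht₀)
  have hlow : ∀ x ∈ Metric.ball z (m / 2), ∀ t ∈ Set.Icc (0 : ℝ) 1,
      m / 2 ≤ ‖1 - x * (t : ℂ)‖ := by
    intro x hx t ht
    have h1 : m ≤ ‖1 - z * (t : ℂ)‖ := hmin ht
    have h2 : ‖(x - z) * (t : ℂ)‖ ≤ m / 2 := by
      rw [norm_mul, Complex.norm_real, Real.norm_of_nonneg ht.1]
      exact (mul_le_of_le_one_right (norm_nonneg _) ht.2).trans (mem_ball_iff_norm.1 hx).le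
    have h3 := norm_add_le (1 - x * (t : ℂ)) ((x - z) * (t : ℂ))
    have h4 : 1 - x * (t : ℂ) + (x - z) * (t : ℂ) = 1 - z * (t : ℂ) := by ring
    rw [h4] at h3
    linarith
  have hlog : IntervalIntegrable (fun t : ℝ => Real.log t ^ 2) MeasureTheory.volume 0 1 := by
    simpa using (trilog_moment 0).1
  have hmeas : ∀ x : ℂ, Measurable fun t : ℝ =>
      ((Real.log t : ℝ) : ℂ) ^ 2 / (1 - x * (t : ℂ)) := fun x => by fun_prop
  have hmeas' : Measurable fun t : ℝ =>
      ((Real.log t : ℝ) : ℂ) ^ 2 * ((t : ℂ) / (1 - z * (t : ℂ)) ^ 2) := by fun_prop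
  have hioc : ∀ t ∈ Set.uIoc (0 : ℝ) 1, t ∈ Set.Icc (0 : ℝ) 1 := fun t ht => by
    rw [Set.uIoc_of_le zero_le_one] at ht
    exact ⟨ht.1.le, ht.2⟩
  have hz0 : z ∈ Metric.ball z (m / 2) := Metric.mem_ball_self (by positivity)
  have main := intervalIntegral.hasDerivAt_integral_of_dominated_loc_of_deriv_le
    (μ := MeasureTheory.volume) (a := 0) (b := 1) (x₀ := z)
    (F := fun (x : ℂ) (t : ℝ) => ((Real.log t : ℝ) : ℂ) ^ 2 / (1 - x * (t : ℂ)))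
    (F' := fun (x : ℂ) (t : ℝ) =>
      ((Real.log t : ℝ) : ℂ) ^ 2 * ((t : ℂ) / (1 - x * (t : ℂ)) ^ 2))
    (bound := fun t => Real.log t ^ 2 * (1 / (m / 2) ^ 2))
    (Metric.ball_mem_nhds z (half_pos hm0))
    (Filter.Eventually.of_forall fun x => (hmeas x).aestronglyMeasurable)
    ?_ hmeas'.aestronglyMeasurable ?_ (hlog.mul_const _) ?_
  · exact ((differentiableAt_id.div_const 2).mul main.2.differentiableAt).differentiableWithinAt
  · refine (hlog.mul_const (1 / (m / 2))).mono_fun (hmeas z).aestronglyMeasurable ?_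
    filter_upwards [MeasureTheory.ae_restrict_mem measurableSet_uIoc] with t ht
    have h := hlow z hz0 t (hioc t ht)
    rw [norm_div, norm_pow, Complex.norm_real, norm_mul, norm_pow, div_eq_mul_one_div]
    rw [Real.norm_of_nonneg (by positivity : 0 ≤ 1 / (m / 2))]
    gcongr
  · refine Filter.Eventually.of_forall fun t ht x hx => ?_
    have h := hlow x hx t (hioc t ht)
    have ht1 : ‖(t : ℂ)‖ ≤ 1 := by
      rw [Complex.norm_real, Real.norm_of_nonneg (hioc t ht).1]
      exact (hioc t ht).2
    rw [norm_mul, norm_div, norm_pow, norm_pow, Complex.norm_real, Real.norm_eq_abs, sq_abs]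
    gcongr
  · refine Filter.Eventually.of_forall fun t ht x hx => ?_
    have h0 : 1 - x * (t : ℂ) ≠ 0 :=
      norm_pos_iff.1 ((half_pos hm0).trans_le (hlow x hx t (hioc t ht)))
    have hd : HasDerivAt (fun x : ℂ => 1 - x * (t : ℂ)) (-(t : ℂ)) x := by
      simpa using ((hasDerivAt_id x).mul_const (t : ℂ)).const_sub 1
    refine ((hd.inv h0).const_mul (((Real.log t : ℝ) : ℂ) ^ 2)).congr_deriv ?_
    ring

open Filter Topology MeasureTheory

/-! Write M(m) for the moment ∫₀¹ u^m/(1+u²) du. The digamma difference at k, n equals 4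
M(2(k+n+1)), so the series is S(n+1), where S(m) = ∑_{k≥1} (-1)^k M(2(k+m))/k². The identification
(`realDigammaDiff_eq`) holds because both sides satisfy the same two-term recursion and tend to 0.

Since M(a) + M(a+2) = 1/(a+1), the sum S(m) + S(m+1) is ∑ (-1)^k / (k²(2k+2m+1)). Partial fractions
evaluate this by π², ln 2 and M(2m+2), and M(2m+2) is, up to sign, π/4 minus a partial sum of
Leibniz's series (`hasSum_moment_succ`, `cauchyMoment_even`). Two steps of this recursion produce
one new term in each finite sum of the statement; the parity of n decides the signs.

The transcendental part is S(0) = ∫₀¹ Li₂(-u²)/(1+u²) du (`hasSum_cauchyMoment`). Integration by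
parts against arctan leaves log(1+u²) arctan(u)/u, which is the imaginary part of log²(1+iu)/u. The
latter has a primitive in logarithms, Li₂ and Li₃ at 1+iu. Its endpoint values need Li₂(1+i),
obtained from the reflection formula and Li₂(-i); only Im Li₃(1+i) remains unevaluated.

`HasSum` is unconditional summation, so it includes absolute convergence over ℂ. The index k starts
at 0 and stands for k+1 in the series. -/

/-! ### Moments of 1/(1+u²) on [0, 1] -/

/-- The moments `∫₀¹ u^m / (1 + u²) du`. -/
noncomputable def cauchyMoment (m : ℕ) : ℝ := ∫ u in (0 : ℝ)..1, u ^ m / (1 + u ^ 2)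

theorem continuous_pow_div_one_add_sq (m : ℕ) :
    Continuous fun u : ℝ => u ^ m / (1 + u ^ 2) :=
  (continuous_pow m).div (by fun_prop) fun u => by positivity

theorem cauchyMoment_zero : cauchyMoment 0 = π / 4 := by
  simp [cauchyMoment]

theorem cauchyMoment_one : cauchyMoment 1 = Real.log 2 / 2 := by
  have h : ∀ u ∈ Set.uIcc (0 : ℝ) 1,
      HasDerivAt (fun u : ℝ => Real.log (1 + u ^ 2) / 2) (u ^ 1 / (1 + u ^ 2)) u := by
    intro u _
    have := (((hasDerivAt_pow 2 u).const_add 1).log (by positivity)).div_const 2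
    refine this.congr_deriv ?_
    have : 1 + u ^ 2 ≠ 0 := by positivity
    field_simp
    norm_num
    ring
  rw [cauchyMoment, intervalIntegral.integral_eq_sub_of_hasDerivAt h
    ((continuous_pow_div_one_add_sq 1).intervalIntegrable _ _)]
  norm_num

theorem cauchyMoment_add (m : ℕ) :
    cauchyMoment m + cauchyMoment (m + 2) = 1 / ((m : ℝ) + 1) := by
  rw [cauchyMoment, cauchyMoment, ← intervalIntegral.integral_add
    ((continuous_pow_div_one_add_sq _).intervalIntegrable _ _)
    ((continuous_pow_div_one_add_sq _).intervalIntegrable _ _)]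
  have : ∀ u : ℝ, u ^ m / (1 + u ^ 2) + u ^ (m + 2) / (1 + u ^ 2) = u ^ m := by
    intro u
    have : 1 + u ^ 2 ≠ 0 := by positivity
    field_simp
    ring
  simp [this]

theorem cauchyMoment_nonneg (m : ℕ) : 0 ≤ cauchyMoment m :=
  intervalIntegral.integral_nonneg zero_le_one fun u hu =>
    div_nonneg (pow_nonneg hu.1 _) (by positivity)

theorem cauchyMoment_le (m : ℕ) : cauchyMoment m ≤ 1 / ((m : ℝ) + 1) := by
  rw [← cauchyMoment_add]
  exact le_add_of_nonneg_right (cauchyMoment_nonneg _)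

theorem tendsto_cauchyMoment : Tendsto cauchyMoment atTop (𝓝 0) :=
  squeeze_zero cauchyMoment_nonneg cauchyMoment_le tendsto_one_div_add_atTop_nhds_zero_nat

/-- Iterating the two-term recursion from M(0) = π/4 builds the partial sums of Leibniz's series;
these become the inner sums over j in the final formulas. -/
theorem cauchyMoment_even (n : ℕ) : cauchyMoment (2 * n) =
    (-1) ^ n * (π / 4 - ∑ j ∈ Finset.range n, (-1 : ℝ) ^ j / (2 * (j : ℝ) + 1)) := by
  induction n with
  | zero => simp [cauchyMoment_zero]
  | succ n ih =>
    have h := cauchyMoment_add (2 * n)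
    rw [ih] at h
    have hs : ((-1 : ℝ) ^ n) * (-1) ^ n = 1 := by rw [← mul_pow]; simp
    rw [Finset.sum_range_succ, mul_add, mul_one]
    push_cast at h
    rw [pow_succ]
    linear_combination h - 1 / (2 * (n : ℝ) + 1) * hs

/-! ### Alternating series -/

/-- Partial sums of `∑ (-1)^k / (2k+m)` telescope through the moments. -/
theorem sum_alternating_eq (m N : ℕ) :
    ∑ k ∈ Finset.range N, (-1 : ℝ) ^ (k + 1) / (2 * ((k : ℝ) + 1) + m) =
      -cauchyMoment (m + 1) + (-1) ^ N * cauchyMoment (2 * N + m + 1) := by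
  induction N with
  | zero => simp
  | succ N ih =>
    have h := cauchyMoment_add (2 * N + m + 1)
    rw [Finset.sum_range_succ, ih]
    rw [show 2 * (N + 1) + m + 1 = 2 * N + m + 1 + 2 by ring]
    push_cast at h
    rw [show 2 * ((N : ℝ) + 1) + m = 2 * N + m + 1 + 1 by ring, div_eq_mul_one_div, ← h, pow_succ]
    ring

theorem tendsto_sum_alternating (m : ℕ) :
    Tendsto (fun N => ∑ k ∈ Finset.range N, (-1 : ℝ) ^ (k + 1) / (2 * ((k : ℝ) + 1) + m)) atTop
      (𝓝 (-cauchyMoment (m + 1))) := by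
  simp only [sum_alternating_eq]
  have h : Tendsto (fun N : ℕ => (-1 : ℝ) ^ N * cauchyMoment (2 * N + m + 1)) atTop (𝓝 0) := by
    rw [tendsto_zero_iff_abs_tendsto_zero]
    simp only [Function.comp_def, abs_mul, abs_pow, abs_neg, abs_one, one_pow, one_mul]
    have := tendsto_cauchyMoment.abs
    rw [abs_zero] at this
    refine this.comp (tendsto_atTop_mono (fun n => ?_) tendsto_id)
    simp only [id]
    omega
  simpa using h.const_add (-cauchyMoment (m + 1))

theorem hasSum_one_div_succ_sq : HasSum (fun k : ℕ => 1 / ((k : ℝ) + 1) ^ 2) (π ^ 2 / 6) := by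
  have h := (hasSum_nat_add_iff' 1).2 hasSum_zeta_two
  simpa using h

theorem hasSum_alternating_zeta_two :
    HasSum (fun k : ℕ => (-1 : ℝ) ^ (k + 1) / ((k : ℝ) + 1) ^ 2) (-(π ^ 2 / 12)) := by
  -- The numerator kills odd n and doubles even n, leaving half of ζ(2); the term n = 0 is 0 by the
  -- convention for division by zero.
  have h1 : HasSum (fun n : ℕ => (1 + (-1 : ℝ) ^ n) / (n : ℝ) ^ 2) (π ^ 2 / 12) := by
    have hinj : Function.Injective fun n : ℕ => 2 * n := fun a b h => by simpa using h
    rw [← hinj.hasSum_iff]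
    · have h := hasSum_zeta_two.mul_left (1 / 2)
      rw [show 1 / 2 * (π ^ 2 / 6) = π ^ 2 / 12 by ring] at h
      refine h.congr_fun fun n => ?_
      simp only [Function.comp_apply, pow_mul, neg_one_sq, one_pow]
      push_cast
      ring
    · intro x hx
      have : Odd x := by
        rw [← Nat.not_even_iff_odd]
        rintro ⟨y, hy⟩
        exact hx ⟨y, by simp only; omega⟩
      simp [this.neg_one_pow]
  have h2 := (hasSum_nat_add_iff' 1).2 (h1.sub hasSum_zeta_two)
  have h3 : π ^ 2 / 12 - π ^ 2 / 6 - ∑ i ∈ Finset.range 1, ((1 + (-1 : ℝ) ^ i) / (i : ℝ) ^ 2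
      - 1 / (i : ℝ) ^ 2) = -(π ^ 2 / 12) := by
    simp; ring
  rw [h3] at h2
  refine h2.congr_fun fun k => ?_
  push_cast
  ring

theorem summable_alternating_div {f : ℕ → ℝ} {C : ℝ} (h0 : ∀ k, 0 ≤ f k) (hf : ∀ k, f k ≤ C) :
    Summable fun k : ℕ => (-1 : ℝ) ^ (k + 1) * f k / ((k : ℝ) + 1) ^ 2 := by
  refine Summable.of_norm_bounded (hasSum_one_div_succ_sq.summable.mul_left C) fun k => ?_
  rw [norm_div, norm_mul, norm_pow, norm_neg, norm_one, one_pow, one_mul, Real.norm_of_nonneg (h0 k),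
    Real.norm_of_nonneg (by positivity), mul_one_div]
  gcongr
  exact hf k

/-- Partial fractions: 1/(k²(2k+c)) = 1/(c k²) - (4/c²)/(2k) + (4/c²)/(2k+c). The last two pieces
converge only conditionally, so the value is found as a limit of partial sums and then transferred
to the absolutely convergent whole. -/
theorem hasSum_alternating_sq_mul_linear {c : ℕ} (hc : c ≠ 0) :
    HasSum (fun k : ℕ => (-1 : ℝ) ^ (k + 1) * (1 / (2 * ((k : ℝ) + 1) + c)) / ((k : ℝ) + 1) ^ 2)
      (-(π ^ 2 / (12 * c)) + 2 * Real.log 2 / c ^ 2 - 4 / c ^ 2 * cauchyMoment (c + 1)) := by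
  have hs : Summable fun k : ℕ =>
      (-1 : ℝ) ^ (k + 1) * (1 / (2 * ((k : ℝ) + 1) + c)) / ((k : ℝ) + 1) ^ 2 :=
    summable_alternating_div (C := 1) (fun k => by positivity) fun k => by
      rw [div_le_one (by positivity)]
      have : (0 : ℝ) ≤ k := by positivity
      have : (0 : ℝ) ≤ c := by positivity
      linarith
  have h1 := (hasSum_alternating_zeta_two.tendsto_sum_nat.mul_const (1 / (c : ℝ)))
  have h2 := (tendsto_sum_alternating 0).mul_const (4 / (c : ℝ) ^ 2)
  have h3 := (tendsto_sum_alternating c).mul_const (4 / (c : ℝ) ^ 2)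
  have h := (h1.sub h2).add h3
  have hlim := hs.hasSum.tendsto_sum_nat
  have hc' : (c : ℝ) ≠ 0 := by exact_mod_cast hc
  have he : ∑' k : ℕ, (-1 : ℝ) ^ (k + 1) * (1 / (2 * ((k : ℝ) + 1) + c)) / ((k : ℝ) + 1) ^ 2 =
      -(π ^ 2 / (12 * c)) + 2 * Real.log 2 / c ^ 2 - 4 / c ^ 2 * cauchyMoment (c + 1) := by
    refine (tendsto_nhds_unique hlim (h.congr fun N => ?_)).trans ?_
    · rw [Finset.sum_mul, Finset.sum_mul, Finset.sum_mul, ← Finset.sum_sub_distrib,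
        ← Finset.sum_add_distrib]
      refine Finset.sum_congr rfl fun k _ => ?_
      have h4 : (k : ℝ) + 1 ≠ 0 := by positivity
      have h5 : 2 * ((k : ℝ) + 1) + c ≠ 0 := by positivity
      simp only [Nat.cast_zero, add_zero]
      field_simp
      ring
    · rw [zero_add, cauchyMoment_one]
      field_simp
      ring
  rw [← he]
  exact hs.hasSum

/-! ### Digamma differences as moments -/

/-- The difference f - g changes sign at each step, so its absolute value is constant, and it tends
to 0. -/
theorem eq_of_add_succ_eq {f g : ℕ → ℝ} (h : ∀ s, f s + f (s + 1) = g s + g (s + 1))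
    (hf : Tendsto f atTop (𝓝 0)) (hg : Tendsto g atTop (𝓝 0)) (s : ℕ) : f s = g s := by
  have hconst : ∀ k, |f (k + s) - g (k + s)| = |f s - g s| := by
    intro k
    induction k with
    | zero => simp
    | succ k ih =>
      rw [← ih, ← abs_neg]
      congr 1
      rw [add_right_comm]
      linarith [h (k + s)]
  have hlim := ((hf.sub hg).comp (tendsto_add_atTop_nat s)).abs
  simp only [Function.comp_def, hconst, sub_zero, abs_zero] at hlim
  have := tendsto_nhds_unique hlim tendsto_const_nhds
  linarith [abs_eq_zero.1 this.symm]

theorem neg_natCast_ne_of_pos {x : ℝ} (hx : 0 < x) (m : ℕ) : x ≠ -m := by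
  have : (0 : ℝ) ≤ m := by positivity
  intro h
  linarith

/-- Passing to the real line makes the log-convexity of Γ available, which supplies the monotonicity
of ψ. -/
theorem digamma_ofReal {x : ℝ} (hx : 0 < x) :
    Complex.digamma x = ((deriv (Real.log ∘ Real.Gamma) x : ℝ) : ℂ) := by
  have hr := (Real.differentiableAt_Gamma (neg_natCast_ne_of_pos hx)).hasDerivAt
  have hc := (Complex.differentiableAt_Gamma (x : ℂ) fun m => by
    have := neg_natCast_ne_of_pos hx m
    exact_mod_cast this).hasDerivAt
  have h : deriv Complex.Gamma x = ((deriv Real.Gamma x : ℝ) : ℂ) := by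
    have h1 := hc.comp_ofReal
    simp only [Complex.Gamma_ofReal] at h1
    exact h1.unique hr.ofReal_comp
  have hd : deriv (Real.log ∘ Real.Gamma) x = deriv Real.Gamma x / Real.Gamma x :=
    (hr.log (Real.Gamma_pos_of_pos hx).ne').deriv
  rw [Complex.digamma_def, logDeriv_apply, h, Complex.Gamma_ofReal, hd, Complex.ofReal_div]

/-- The digamma difference along the reals. -/
noncomputable def realDigammaDiff (s : ℕ) : ℝ :=
  deriv (Real.log ∘ Real.Gamma) ((2 * s + 5) / 4) - deriv (Real.log ∘ Real.Gamma) ((2 * s + 3) / 4)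

theorem digammaDiff_eq_ofReal (k n : ℕ) : digammaDiff k n = (realDigammaDiff (k + n) : ℂ) := by
  rw [digammaDiff, realDigammaDiff, Complex.ofReal_sub, ← digamma_ofReal (by positivity),
    ← digamma_ofReal (by positivity)]
  push_cast
  ring_nf

theorem deriv_log_Gamma_add_one {x : ℝ} (hx : 0 < x) :
    deriv (Real.log ∘ Real.Gamma) (x + 1) = deriv (Real.log ∘ Real.Gamma) x + 1 / x := by
  have h := Complex.digamma_apply_add_one (x : ℂ) fun m => by
    have := neg_natCast_ne_of_pos hx m
    exact_mod_cast this
  have h1 : (x : ℂ) + 1 = ((x + 1 : ℝ) : ℂ) := by push_cast; rfl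
  rw [h1, digamma_ofReal (by positivity), digamma_ofReal hx] at h
  rw [one_div]
  exact_mod_cast h

theorem monotoneOn_deriv_log_Gamma : MonotoneOn (deriv (Real.log ∘ Real.Gamma)) (Set.Ioi 0) :=
  Real.convexOn_log_Gamma.monotoneOn_deriv fun _ hx =>
    (Real.differentiableAt_Gamma (neg_natCast_ne_of_pos hx)).log (Real.Gamma_pos_of_pos hx).ne'

/-- With x = (2s+3)/4, consecutive differences add up to ψ(x+1) - ψ(x) = 1/x, which is the moment
recursion times 4. Decay follows from monotonicity: 0 ≤ ψ(x+1/2) - ψ(x) ≤ ψ(x+1) - ψ(x) = 1/x. -/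
theorem realDigammaDiff_eq (s : ℕ) : realDigammaDiff s = 4 * cauchyMoment (2 * s + 2) := by
  refine eq_of_add_succ_eq (g := fun s => 4 * cauchyMoment (2 * s + 2)) (fun s => ?_) ?_ ?_ s
  · have h := cauchyMoment_add (2 * s + 2)
    have h1 := deriv_log_Gamma_add_one (x := (2 * s + 3) / 4) (by positivity)
    rw [← mul_add, mul_add 2 s 1, mul_one, h, realDigammaDiff, realDigammaDiff]
    push_cast
    rw [show (2 * ((s : ℝ) + 1) + 5) / 4 = (2 * s + 3) / 4 + 1 by ring, h1,
      show (2 * ((s : ℝ) + 1) + 3) / 4 = (2 * s + 5) / 4 by ring]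
    have : 2 * (s : ℝ) + 3 ≠ 0 := by positivity
    field_simp
    ring
  · refine squeeze_zero (g := fun s : ℕ => 4 * (1 / ((s : ℝ) + 1))) (fun s => ?_) (fun s => ?_) ?_
    · refine sub_nonneg.2 (monotoneOn_deriv_log_Gamma ?_ ?_ ?_)
      · exact Set.mem_Ioi.2 (by positivity)
      · exact Set.mem_Ioi.2 (by positivity)
      · linarith
    · have h1 := deriv_log_Gamma_add_one (x := (2 * s + 3) / 4) (by positivity)
      have h2 : deriv (Real.log ∘ Real.Gamma) ((2 * s + 5) / 4) ≤
          deriv (Real.log ∘ Real.Gamma) ((2 * s + 3) / 4 + 1) :=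
        monotoneOn_deriv_log_Gamma (Set.mem_Ioi.2 (by positivity)) (Set.mem_Ioi.2 (by positivity))
          (by linarith)
      have h3 : 1 / ((2 * (s : ℝ) + 3) / 4) ≤ 4 * (1 / ((s : ℝ) + 1)) := by
        rw [one_div_div, mul_one_div]
        refine div_le_div_of_nonneg_left (by norm_num) (by positivity) ?_
        linarith [(Nat.cast_nonneg s : (0 : ℝ) ≤ s)]
      rw [realDigammaDiff]
      linarith
    · simpa using tendsto_one_div_add_atTop_nhds_zero_nat.const_mul (4 : ℝ)
  · have : Tendsto (fun s : ℕ => 2 * s + 2) atTop atTop :=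
      tendsto_atTop_mono (fun n => by simp only [id]; omega) tendsto_id
    simpa using (tendsto_cauchyMoment.comp this).const_mul 4

/-! ### The dilogarithm: integral and series -/

/-- The principal branch of the dilogarithm, `Li₂(z) = -z ∫₀¹ log t / (1 - z t) dt`. -/
noncomputable def dilog (z : ℂ) : ℂ :=
  z * ∫ t in (0 : ℝ)..1, ((-Real.log t : ℝ) : ℂ) / (1 - z * (t : ℂ))

theorem trilog_eq (z : ℂ) :
    trilog z = 1 / 2 * (z * ∫ t in (0 : ℝ)..1, ((Real.log t ^ 2 : ℝ) : ℂ) / (1 - z * (t : ℂ))) := by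
  rw [trilog]
  push_cast
  ring

theorem continuousOn_mul_log_sq : ContinuousOn (fun t : ℝ => t * Real.log t ^ 2) (Set.Icc 0 1) := by
  have hc : Continuous fun t : ℝ => 4 * (√t * Real.log √t) ^ 2 :=
    continuous_const.mul ((Real.continuous_mul_log.comp Real.continuous_sqrt).pow 2)
  refine hc.continuousOn.congr fun t ht => ?_
  have h : √t ^ 2 = t := Real.sq_sqrt ht.1
  simp only [Real.log_sqrt ht.1, mul_pow, h]
  ring

theorem dilog_moment (k : ℕ) :
    IntervalIntegrable (fun t : ℝ => t ^ k * -Real.log t) volume 0 1 ∧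
      ∫ t in (0 : ℝ)..1, t ^ k * -Real.log t = 1 / ((k : ℝ) + 1) ^ 2 := by
  -- The primitive is grouped around t log t, which is continuous at 0.
  set F : ℝ → ℝ := fun t => t ^ k * (t / ((k : ℝ) + 1) ^ 2 - t * Real.log t / (k + 1)) with hF
  have hk : (k : ℝ) + 1 ≠ 0 := by positivity
  have hcont : ContinuousOn F (Set.Icc 0 1) := by
    have := Real.continuous_mul_log
    refine Continuous.continuousOn ?_
    fun_prop
  have hderiv : ∀ t ∈ Set.Ioo (0 : ℝ) 1, HasDerivAt F (t ^ k * -Real.log t) t := by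
    intro t ht
    have ht0 : t ≠ 0 := ht.1.ne'
    have hp : HasDerivAt (fun t : ℝ => t ^ (k + 1) * (1 / ((k : ℝ) + 1) ^ 2
        - Real.log t / (k + 1))) (t ^ k * -Real.log t) t := by
      have := (hasDerivAt_pow (k + 1) t).mul
        (((Real.hasDerivAt_log ht0).div_const ((k : ℝ) + 1)).const_sub (1 / ((k : ℝ) + 1) ^ 2))
      refine this.congr_deriv ?_
      simp only [Nat.add_sub_cancel, Nat.cast_add, Nat.cast_one, pow_succ]
      field_simp
      ring
    refine hp.congr_of_eventuallyEq (Filter.Eventually.of_forall fun s => ?_)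
    simp only [hF]
    ring
  have hint : IntervalIntegrable (fun t : ℝ => t ^ k * -Real.log t) volume 0 1 := by
    refine intervalIntegral.intervalIntegrable_deriv_of_nonneg (g := F) ?_ ?_ ?_
    · rwa [Set.uIcc_of_le zero_le_one]
    · simpa using hderiv
    · intro t ht
      simp only [zero_le_one, min_eq_left, max_eq_right, Set.mem_Ioo] at ht
      exact mul_nonneg (pow_nonneg ht.1.le _)
        (neg_nonneg.2 (Real.log_nonpos ht.1.le ht.2.le))
  refine ⟨hint, ?_⟩
  rw [intervalIntegral.integral_eq_sub_of_hasDerivAt_of_le zero_le_one hcont hderiv hint]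
  simp [hF]

theorem hasSum_dilog {z : ℂ} (hz : ‖z‖ ≤ 1) :
    HasSum (fun k : ℕ => z ^ (k + 1) / ((k : ℂ) + 1) ^ 2) (dilog z) := by
  set g : ℕ → ℝ → ℂ := fun k t => z ^ k * ((t ^ k * -Real.log t : ℝ) : ℂ) with hg
  have hgi : ∀ k, Integrable (g k) (volume.restrict (Set.Ioc (0 : ℝ) 1)) := fun k =>
    (((intervalIntegrable_iff_integrableOn_Ioc_of_le zero_le_one).1
      (dilog_moment k).1).ofReal).const_mul _
  have hnorm : ∀ k, ∫ t in Set.Ioc (0 : ℝ) 1, ‖g k t‖ ≤ 1 / ((k : ℝ) + 1) ^ 2 := by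
    intro k
    rw [← (dilog_moment k).2, intervalIntegral.integral_of_le zero_le_one]
    refine setIntegral_mono_on (hgi k).norm
      ((intervalIntegrable_iff_integrableOn_Ioc_of_le zero_le_one).1 (dilog_moment k).1)
      measurableSet_Ioc fun t ht => ?_
    have h0 : 0 ≤ t ^ k * -Real.log t :=
      mul_nonneg (pow_nonneg ht.1.le _) (neg_nonneg.2 (Real.log_nonpos ht.1.le ht.2))
    simp only [hg]
    rw [norm_mul, norm_pow, Complex.norm_real, Real.norm_of_nonneg h0]
    exact mul_le_of_le_one_left h0 (pow_le_one₀ (norm_nonneg _) hz)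
  have hsum : Summable fun k => ∫ t in Set.Ioc (0 : ℝ) 1, ‖g k t‖ :=
    Summable.of_nonneg_of_le (fun k => by positivity) hnorm hasSum_one_div_succ_sq.summable
  have key := (hasSum_integral_of_summable_integral_norm hgi hsum).mul_left z
  have hrhs : ∫ t in Set.Ioc (0 : ℝ) 1, ∑' k, g k t
      = ∫ t in (0 : ℝ)..1, ((-Real.log t : ℝ) : ℂ) / (1 - z * (t : ℂ)) := by
    rw [intervalIntegral.integral_of_le zero_le_one, integral_Ioc_eq_integral_Ioo,
      integral_Ioc_eq_integral_Ioo]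
    refine setIntegral_congr_fun measurableSet_Ioo fun t ht => ?_
    have hlt : ‖z * (t : ℂ)‖ < 1 := by
      rw [norm_mul, Complex.norm_real, Real.norm_of_nonneg ht.1.le]
      exact (mul_le_of_le_one_left ht.1.le hz).trans_lt ht.2
    have := ((hasSum_geometric_of_norm_lt_one hlt).mul_left ((-Real.log t : ℝ) : ℂ)).tsum_eq
    simp only [div_eq_mul_inv]
    rw [← this]
    refine tsum_congr fun k => ?_
    simp only [hg]
    push_cast
    ring
  rw [hrhs] at key
  refine key.congr_fun fun k => ?_
  simp only [hg]
  rw [integral_const_mul, integral_complex_ofReal,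
    ← intervalIntegral.integral_of_le zero_le_one, (dilog_moment k).2]
  push_cast
  field_simp
  ring

/-! ### Continuity on the half-plane Re z ≤ 1 -/

theorem one_sub_le_norm {z : ℂ} (hz : z.re ≤ 1) {t : ℝ} (ht : 0 ≤ t) :
    1 - t ≤ ‖1 - z * (t : ℂ)‖ := by
  refine le_trans ?_ (Complex.re_le_norm _)
  simp only [Complex.sub_re, Complex.one_re, Complex.mul_re, Complex.ofReal_re, Complex.ofReal_im,
    mul_zero, sub_zero]
  nlinarith

/-- For Re z ≤ 1 one has |1 - zt| ≥ 1 - t, a bound uniform in z. It reaches the branch point z = 1,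
where the path 1+iu starts. -/
theorem continuousOn_integral_div {w : ℝ → ℝ} (hm : Measurable w)
    (hw : IntervalIntegrable (fun t => |w t| / (1 - t)) volume 0 1) :
    ContinuousOn (fun z : ℂ => ∫ t in (0 : ℝ)..1, (w t : ℂ) / (1 - z * (t : ℂ)))
      {z | z.re ≤ 1} := by
  intro z hz
  have hne : ∀ᵐ t : ℝ, t ≠ 1 := compl_mem_ae_iff.2 (measure_singleton 1)
  refine intervalIntegral.continuousWithinAt_of_dominated_interval
    (bound := fun t => |w t| / (1 - t)) ?_ ?_ hw ?_
  · exact Eventually.of_forall fun x =>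
      Measurable.aestronglyMeasurable (by fun_prop)
  · filter_upwards [self_mem_nhdsWithin] with x hx
    filter_upwards [hne] with t ht1 ht
    rw [Set.uIoc_of_le zero_le_one] at ht
    have : 0 < 1 - t := sub_pos.2 (lt_of_le_of_ne ht.2 ht1)
    rw [norm_div, Complex.norm_real, Real.norm_eq_abs]
    gcongr
    exact one_sub_le_norm hx ht.1.le
  · filter_upwards [hne] with t ht1 ht
    rw [Set.uIoc_of_le zero_le_one] at ht
    have : 0 < 1 - t := sub_pos.2 (lt_of_le_of_ne ht.2 ht1)
    refine (ContinuousAt.div (by fun_prop) (by fun_prop) ?_).continuousWithinAt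
    exact norm_pos_iff.1 (this.trans_le (one_sub_le_norm hz ht.1.le))

/-- For t ≤ 1/2 the denominator is at least 1/2; for t ≥ 1/2, -log t ≤ (1-t)/t ≤ 2(1-t). -/
theorem neg_log_div_one_sub_le {t : ℝ} (h0 : 0 < t) (h1 : t < 1) :
    -Real.log t / (1 - t) ≤ 2 * -Real.log t + 2 := by
  have hl : 0 ≤ -Real.log t := neg_nonneg.2 (Real.log_nonpos h0.le h1.le)
  rw [div_le_iff₀ (sub_pos.2 h1)]
  rcases le_total t (1 / 2) with h | h
  · nlinarith
  · have h2 := Real.one_sub_inv_le_log_of_pos h0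
    have h3 : t⁻¹ ≤ 2 := by
      rw [inv_le_comm₀ h0 two_pos]
      linarith
    have h4 : t⁻¹ * t = 1 := inv_mul_cancel₀ h0.ne'
    nlinarith [mul_nonneg hl (sub_nonneg.2 h1.le)]

theorem intervalIntegrable_neg_log : IntervalIntegrable (fun t => -Real.log t) volume 0 1 := by
  simpa using (dilog_moment 0).1

theorem intervalIntegrable_log_sq : IntervalIntegrable (fun t => Real.log t ^ 2) volume 0 1 := by
  simpa using (trilog_moment 0).1

theorem intervalIntegrable_log_div :
    IntervalIntegrable (fun t => |-Real.log t| / (1 - t)) volume 0 1 := by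
  refine ((intervalIntegrable_neg_log.const_mul 2).add
    (intervalIntegrable_const (c := (2 : ℝ)))).mono_fun
    (Measurable.aestronglyMeasurable (by fun_prop)) ?_
  filter_upwards [ae_restrict_mem measurableSet_uIoc] with t ht
  rw [Set.uIoc_of_le zero_le_one] at ht
  rcases eq_or_lt_of_le ht.2 with rfl | h1
  · simp
  have hl : 0 ≤ -Real.log t := neg_nonneg.2 (Real.log_nonpos ht.1.le h1.le)
  rw [abs_of_nonneg hl, Real.norm_of_nonneg (div_nonneg hl (sub_nonneg.2 h1.le)),
    Real.norm_of_nonneg (by positivity)]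
  exact neg_log_div_one_sub_le ht.1 h1

theorem intervalIntegrable_log_sq_div :
    IntervalIntegrable (fun t => |Real.log t ^ 2| / (1 - t)) volume 0 1 := by
  refine ((intervalIntegrable_log_sq.const_mul 2).add
    (intervalIntegrable_neg_log.const_mul 2)).mono_fun
    (Measurable.aestronglyMeasurable (by fun_prop)) ?_
  filter_upwards [ae_restrict_mem measurableSet_uIoc] with t ht
  rw [Set.uIoc_of_le zero_le_one] at ht
  rcases eq_or_lt_of_le ht.2 with rfl | h1
  · simp
  have hl : 0 ≤ -Real.log t := neg_nonneg.2 (Real.log_nonpos ht.1.le h1.le)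
  rw [abs_of_nonneg (sq_nonneg _), Real.norm_of_nonneg (div_nonneg (sq_nonneg _)
    (sub_nonneg.2 h1.le)), Real.norm_of_nonneg (by positivity)]
  calc Real.log t ^ 2 / (1 - t) = -Real.log t * (-Real.log t / (1 - t)) := by ring
    _ ≤ -Real.log t * (2 * -Real.log t + 2) :=
      mul_le_mul_of_nonneg_left (neg_log_div_one_sub_le ht.1 h1) hl
    _ = 2 * Real.log t ^ 2 + 2 * -Real.log t := by ring

theorem continuousOn_dilog : ContinuousOn dilog {z | z.re ≤ 1} :=
  continuousOn_id.mul (continuousOn_integral_div (by fun_prop) intervalIntegrable_log_div)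

theorem continuousOn_trilog : ContinuousOn trilog {z | z.re ≤ 1} := by
  rw [funext trilog_eq]
  exact continuousOn_const.mul
    (continuousOn_id.mul (continuousOn_integral_div (by fun_prop) intervalIntegrable_log_sq_div))

/-! ### Derivatives of Li₂ and Li₃ -/

theorem one_sub_mul_ne_zero {z : ℂ} (hz : ∀ x : ℝ, 1 ≤ x → z ≠ x) {t : ℝ}
    (ht : t ∈ Set.Icc (0 : ℝ) 1) : 1 - z * (t : ℂ) ≠ 0 := by
  intro h
  have h1 : z * (t : ℂ) = 1 := (sub_eq_zero.1 h).symm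
  have ht0 : (t : ℂ) ≠ 0 := right_ne_zero_of_mul_eq_one h1
  have htpos : 0 < t := lt_of_le_of_ne ht.1 fun h0 => ht0 (by simp [← h0])
  refine hz t⁻¹ ((one_le_inv₀ htpos).2 ht.2) ?_
  rw [Complex.ofReal_inv]
  exact eq_inv_of_mul_eq_one_left h1

/-- Differentiation under the integral, using 1/(1-zt) + zt/(1-zt)² = 1/(1-zt)². The weights -log t
and log² t give the two polylogarithms. -/
theorem hasDerivAt_mul_integral_div {w : ℝ → ℝ} (hwm : Measurable w)
    (hw : IntervalIntegrable w volume 0 1) {z : ℂ} (hz : ∀ x : ℝ, 1 ≤ x → z ≠ x) :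
    IntervalIntegrable (fun t : ℝ => (w t : ℂ) / (1 - z * (t : ℂ)) ^ 2) volume 0 1 ∧
    HasDerivAt (fun z : ℂ => z * ∫ t in (0 : ℝ)..1, (w t : ℂ) / (1 - z * (t : ℂ)))
      (∫ t in (0 : ℝ)..1, (w t : ℂ) / (1 - z * (t : ℂ)) ^ 2) z := by
  obtain ⟨t₀, ht₀, hmin⟩ := isCompact_Icc.exists_isMinOn
    (Set.nonempty_Icc.2 (zero_le_one (α := ℝ)))
    (f := fun t : ℝ => ‖1 - z * (t : ℂ)‖) (by fun_prop)
  set m := ‖1 - z * (t₀ : ℂ)‖ with hm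
  have hm0 : 0 < m := norm_pos_iff.2 (one_sub_mul_ne_zero hz ht₀)
  have hlow : ∀ x ∈ Metric.ball z (m / 2), ∀ t ∈ Set.Icc (0 : ℝ) 1,
      m / 2 ≤ ‖1 - x * (t : ℂ)‖ := by
    intro x hx t ht
    have h1 : m ≤ ‖1 - z * (t : ℂ)‖ := hmin ht
    have h2 : ‖(x - z) * (t : ℂ)‖ ≤ m / 2 := by
      rw [norm_mul, Complex.norm_real, Real.norm_of_nonneg ht.1]
      exact (mul_le_of_le_one_right (norm_nonneg _) ht.2).trans (mem_ball_iff_norm.1 hx).le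
    have h3 := norm_add_le (1 - x * (t : ℂ)) ((x - z) * (t : ℂ))
    rw [show 1 - x * (t : ℂ) + (x - z) * (t : ℂ) = 1 - z * (t : ℂ) by ring] at h3
    linarith
  have hioc : ∀ t ∈ Set.uIoc (0 : ℝ) 1, t ∈ Set.Icc (0 : ℝ) 1 := fun t ht => by
    rw [Set.uIoc_of_le zero_le_one] at ht
    exact ⟨ht.1.le, ht.2⟩
  have hz0 : z ∈ Metric.ball z (m / 2) := Metric.mem_ball_self (by positivity)
  have hFint : IntervalIntegrable (fun t : ℝ => (w t : ℂ) / (1 - z * (t : ℂ))) volume 0 1 := by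
    refine (hw.abs.mul_const (1 / (m / 2))).mono_fun
      (Measurable.aestronglyMeasurable (by fun_prop)) ?_
    filter_upwards [ae_restrict_mem measurableSet_uIoc] with t ht
    have h := hlow z hz0 t (hioc t ht)
    rw [norm_div, Complex.norm_real, norm_mul, div_eq_mul_one_div, Real.norm_eq_abs,
      Real.norm_of_nonneg (by positivity : 0 ≤ 1 / (m / 2)),
      Real.norm_eq_abs, abs_abs]
    gcongr
  have main := intervalIntegral.hasDerivAt_integral_of_dominated_loc_of_deriv_le
    (μ := volume) (a := 0) (b := 1) (x₀ := z)
    (F := fun (x : ℂ) (t : ℝ) => (w t : ℂ) / (1 - x * (t : ℂ)))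
    (F' := fun (x : ℂ) (t : ℝ) => (w t : ℂ) * ((t : ℂ) / (1 - x * (t : ℂ)) ^ 2))
    (bound := fun t => |w t| * (1 / (m / 2) ^ 2))
    (Metric.ball_mem_nhds z (half_pos hm0))
    (Eventually.of_forall fun x => Measurable.aestronglyMeasurable (by fun_prop))
    hFint (Measurable.aestronglyMeasurable (by fun_prop)) ?_ (hw.abs.mul_const _) ?_
  · have hcongr : Set.EqOn (fun t : ℝ => (w t : ℂ) / (1 - z * (t : ℂ))
        + z * ((w t : ℂ) * ((t : ℂ) / (1 - z * (t : ℂ)) ^ 2)))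
        (fun t : ℝ => (w t : ℂ) / (1 - z * (t : ℂ)) ^ 2) (Set.uIoc 0 1) := fun t ht => by
      have := one_sub_mul_ne_zero hz (hioc t ht)
      simp only
      field_simp
      ring
    refine ⟨(hFint.add (main.1.const_mul z)).congr hcongr,
      ((hasDerivAt_id z).mul main.2).congr_deriv ?_⟩
    rw [one_mul, id, ← intervalIntegral.integral_const_mul,
      ← intervalIntegral.integral_add hFint (main.1.const_mul z)]
    exact intervalIntegral.integral_congr_ae (Eventually.of_forall fun t ht => hcongr ht)
  · refine Eventually.of_forall fun t ht x hx => ?_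
    have h := hlow x hx t (hioc t ht)
    have ht1 : ‖(t : ℂ)‖ ≤ 1 := by
      rw [Complex.norm_real, Real.norm_of_nonneg (hioc t ht).1]
      exact (hioc t ht).2
    rw [norm_mul, norm_div, norm_pow, Complex.norm_real, Real.norm_eq_abs]
    gcongr
  · refine Eventually.of_forall fun t ht x hx => ?_
    have h0 : 1 - x * (t : ℂ) ≠ 0 :=
      norm_pos_iff.1 ((half_pos hm0).trans_le (hlow x hx t (hioc t ht)))
    have hd : HasDerivAt (fun x : ℂ => 1 - x * (t : ℂ)) (-(t : ℂ)) x := by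
      simpa using ((hasDerivAt_id x).mul_const (t : ℂ)).const_sub 1
    refine ((hd.inv h0).const_mul (w t : ℂ)).congr_deriv ?_
    ring

theorem ne_ofReal_of_re_le_one {z : ℂ} (h1 : z.re ≤ 1) (hne : z ≠ 1) (x : ℝ) (hx : 1 ≤ x) :
    z ≠ x := by
  rintro rfl
  rw [Complex.ofReal_re] at h1
  exact hne (by rw [le_antisymm h1 hx, Complex.ofReal_one])

theorem one_sub_mul_mem_slitPlane {z : ℂ} (h1 : z.re ≤ 1) (hne : z ≠ 1) {t : ℝ}
    (ht : t ∈ Set.Icc (0 : ℝ) 1) : 1 - z * (t : ℂ) ∈ Complex.slitPlane := by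
  have h0 := one_sub_mul_ne_zero (ne_ofReal_of_re_le_one h1 hne) ht
  have hre : 0 ≤ (1 - z * (t : ℂ)).re := by
    simp only [Complex.sub_re, Complex.one_re, Complex.mul_re, Complex.ofReal_re,
      Complex.ofReal_im, mul_zero, sub_zero]
    nlinarith [ht.1, ht.2]
  rw [Complex.mem_slitPlane_iff]
  rcases hre.lt_or_eq with h | h
  · exact Or.inl h
  · exact Or.inr fun him => h0 (Complex.ext h.symm him)

theorem hasDerivAt_one_sub_mul (z : ℂ) (t : ℝ) :
    HasDerivAt (fun t : ℝ => 1 - z * (t : ℂ)) (-z) t := by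
  simpa using ((hasDerivAt_id t).ofReal_comp.const_mul z).const_sub 1

theorem hasDerivAt_dilog {z : ℂ} (h1 : z.re ≤ 1) (hne : z ≠ 1) (hz : z ≠ 0) :
    HasDerivAt dilog (-Complex.log (1 - z) / z) z := by
  have hs := ne_ofReal_of_re_le_one h1 hne
  obtain ⟨hint, hd⟩ := hasDerivAt_mul_integral_div (w := fun t => -Real.log t) (by fun_prop)
    intervalIntegrable_neg_log hs
  refine hd.congr_deriv ?_
  -- A primitive in t of -log t/(1-zt)², continuous on [0, 1] because 1 - zt avoids the cut of the
  -- logarithm.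
  set F : ℝ → ℂ := fun t => -(((t * Real.log t : ℝ) : ℂ) / (1 - z * (t : ℂ)))
    - Complex.log (1 - z * (t : ℂ)) / z with hF
  have hcont : ContinuousOn F (Set.Icc 0 1) := by
    refine ContinuousOn.sub (ContinuousOn.neg (ContinuousOn.div ?_ (by fun_prop)
      fun t ht => one_sub_mul_ne_zero hs ht)) (ContinuousOn.div_const (ContinuousOn.clog
        (by fun_prop) fun t ht => one_sub_mul_mem_slitPlane h1 hne ht) _)
    exact (Complex.continuous_ofReal.comp Real.continuous_mul_log).continuousOn
  have hderiv : ∀ t ∈ Set.Ioo (0 : ℝ) 1,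
      HasDerivAt F (((-Real.log t : ℝ) : ℂ) / (1 - z * (t : ℂ)) ^ 2) t := by
    intro t ht
    have ht' := Set.Ioo_subset_Icc_self ht
    have h0 := one_sub_mul_ne_zero hs ht'
    have hl := hasDerivAt_one_sub_mul z t
    have := ((Real.hasDerivAt_mul_log ht.1.ne').ofReal_comp.div hl h0).neg.sub
      ((hl.clog_real (one_sub_mul_mem_slitPlane h1 hne ht')).div_const z)
    refine this.congr_deriv ?_
    push_cast
    field_simp
    ring
  rw [intervalIntegral.integral_eq_sub_of_hasDerivAt_of_le zero_le_one hcont hderiv hint]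
  simp [hF, neg_div]

theorem hasDerivAt_trilog {z : ℂ} (h1 : z.re ≤ 1) (hne : z ≠ 1) (hz : z ≠ 0) :
    HasDerivAt trilog (dilog z / z) z := by
  have hs := ne_ofReal_of_re_le_one h1 hne
  obtain ⟨hint, hd⟩ := hasDerivAt_mul_integral_div (w := fun t => Real.log t ^ 2) (by fun_prop)
    intervalIntegrable_log_sq hs
  have hint1 : IntervalIntegrable
      (fun t : ℝ => ((-Real.log t : ℝ) : ℂ) / (1 - z * (t : ℂ))) volume 0 1 := by
    refine IntervalIntegrable.mono_fun (f := fun t : ℝ => |-Real.log t| / (1 - t))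
      intervalIntegrable_log_div (Measurable.aestronglyMeasurable (by fun_prop)) ?_
    filter_upwards [ae_restrict_mem measurableSet_uIoc] with t ht
    rw [Set.uIoc_of_le zero_le_one] at ht
    rcases eq_or_lt_of_le ht.2 with rfl | ht1
    · simp
    have : 0 < 1 - t := sub_pos.2 ht1
    rw [norm_div, norm_div, Complex.norm_real, Real.norm_eq_abs, Real.norm_eq_abs, abs_abs,
      Real.norm_of_nonneg this.le]
    gcongr
    exact one_sub_le_norm h1 ht.1.le
  set F : ℝ → ℂ := fun t => ((t * Real.log t ^ 2 : ℝ) : ℂ) / (1 - z * (t : ℂ)) with hF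
  have hcont : ContinuousOn F (Set.Icc 0 1) :=
    ContinuousOn.div (Complex.continuous_ofReal.comp_continuousOn continuousOn_mul_log_sq)
      (by fun_prop) fun t ht => one_sub_mul_ne_zero hs ht
  -- Integration by parts: F vanishes at both ends, so the integral of log² t/(1-zt)² is twice that
  -- of -log t/(1-zt).
  have hderiv : ∀ t ∈ Set.Ioo (0 : ℝ) 1,
      HasDerivAt F (((Real.log t ^ 2 : ℝ) : ℂ) / (1 - z * (t : ℂ)) ^ 2
        - 2 * (((-Real.log t : ℝ) : ℂ) / (1 - z * (t : ℂ)))) t := by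
    intro t ht
    have h0 := one_sub_mul_ne_zero hs (Set.Ioo_subset_Icc_self ht)
    have h2 := (hasDerivAt_id t).mul ((Real.hasDerivAt_log ht.1.ne').pow 2)
    have := h2.ofReal_comp.div (hasDerivAt_one_sub_mul z t) h0
    refine this.congr_deriv ?_
    have : (t : ℂ) ≠ 0 := by exact_mod_cast ht.1.ne'
    simp only [id, Pi.mul_apply, Pi.pow_apply]
    push_cast
    field_simp
    ring
  have hI := intervalIntegral.integral_eq_sub_of_hasDerivAt_of_le zero_le_one hcont hderiv
    (hint.sub (hint1.const_mul 2))
  rw [intervalIntegral.integral_sub hint (hint1.const_mul 2),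
    intervalIntegral.integral_const_mul] at hI
  have hF01 : F 1 - F 0 = 0 := by simp [hF]
  rw [hF01, sub_eq_zero] at hI
  have hd' := (hd.const_mul (1 / 2)).congr_of_eventuallyEq
    (Eventually.of_forall fun y => trilog_eq y)
  refine hd'.congr_deriv ?_
  rw [hI, dilog]
  field_simp

/-! ### Special values of Li₂ -/

theorem dilog_zero : dilog 0 = 0 := by simp [dilog]

theorem dilog_one : dilog 1 = π ^ 2 / 6 := by
  have h := hasSum_dilog (z := 1) (by simp)
  have h2 : HasSum (fun k : ℕ => (1 : ℂ) ^ (k + 1) / ((k : ℂ) + 1) ^ 2) ((π ^ 2 / 6 : ℝ) : ℂ) := by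
    have := Complex.hasSum_ofReal.2 hasSum_one_div_succ_sq
    refine this.congr_fun fun k => ?_
    push_cast
    simp
  rw [h.unique h2]
  push_cast
  rfl

theorem hasSum_catalanG : HasSum (fun k : ℕ => (-1 : ℝ) ^ k / (2 * (k : ℝ) + 1) ^ 2) catalanG := by
  refine Summable.hasSum (Summable.of_norm_bounded hasSum_one_div_succ_sq.summable fun k => ?_)
  rw [norm_div, norm_pow, norm_neg, norm_one, one_pow, Real.norm_of_nonneg (by positivity)]
  gcongr
  linarith [(Nat.cast_nonneg k : (0 : ℝ) ≤ k)]

theorem dilog_neg_one : dilog (-1) = -(π ^ 2 / 12) := by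
  have h := hasSum_dilog (z := -1) (by simp)
  have h2 : HasSum (fun k : ℕ => (-1 : ℂ) ^ (k + 1) / ((k : ℂ) + 1) ^ 2)
      ((-(π ^ 2 / 12) : ℝ) : ℂ) := by
    have := Complex.hasSum_ofReal.2 hasSum_alternating_zeta_two
    refine this.congr_fun fun k => ?_
    push_cast
    simp
  rw [h.unique h2]
  push_cast
  rfl

/-- Odd powers of -i give Catalan's series; even powers give a quarter of the alternating ζ(2)
series. -/
theorem dilog_neg_I : dilog (-Complex.I) = -(π ^ 2 / 48) - catalanG * Complex.I := by
  have h := hasSum_dilog (z := -Complex.I) (by simp)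
  have hsq (j : ℕ) : (-Complex.I) ^ (2 * j) = (-1) ^ j := by
    rw [pow_mul, neg_sq, Complex.I_sq]
  have he : HasSum (fun j : ℕ => (-Complex.I) ^ (2 * j + 1) / (((2 * j : ℕ) : ℂ) + 1) ^ 2)
      (catalanG * -Complex.I) := by
    refine ((Complex.hasSum_ofReal.2 hasSum_catalanG).mul_right (-Complex.I)).congr_fun
      fun j => ?_
    rw [pow_succ, hsq]
    push_cast
    ring
  have ho : HasSum (fun j : ℕ => (-Complex.I) ^ (2 * j + 1 + 1) / (((2 * j + 1 : ℕ) : ℂ) + 1) ^ 2)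
      (((-(π ^ 2 / 12) : ℝ) : ℂ) * (1 / 4)) := by
    refine ((Complex.hasSum_ofReal.2 hasSum_alternating_zeta_two).mul_right (1 / 4)).congr_fun
      fun j => ?_
    rw [show 2 * j + 1 + 1 = 2 * (j + 1) by ring, hsq]
    have : (j : ℂ) + 1 ≠ 0 := by exact_mod_cast j.succ_ne_zero
    push_cast
    rw [show (2 * (j : ℂ) + 1 + 1) = 2 * (j + 1) by ring]
    field_simp
    ring
  have h2 := HasSum.even_add_odd
    (f := fun k : ℕ => (-Complex.I) ^ (k + 1) / ((k : ℂ) + 1) ^ 2) he ho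
  rw [h.unique h2]
  push_cast
  ring

theorem one_add_mul_I_mem_slitPlane (u : ℝ) : 1 + (u : ℂ) * Complex.I ∈ Complex.slitPlane := by
  rw [Complex.mem_slitPlane_iff]
  exact Or.inl (by simp)

theorem log_one_add_mul_I (u : ℝ) : Complex.log (1 + (u : ℂ) * Complex.I) =
    ((Real.log (1 + u ^ 2) / 2 : ℝ) : ℂ) + (Real.arctan u : ℂ) * Complex.I := by
  have hn : ‖1 + (u : ℂ) * Complex.I‖ = √(1 + u ^ 2) := by
    have := Complex.norm_add_mul_I 1 u
    simpa using this
  apply Complex.ext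
  · simp only [Complex.log_re, Complex.add_re, Complex.ofReal_re, Complex.mul_re, Complex.I_re,
      mul_zero, Complex.ofReal_im, Complex.I_im, mul_one, sub_self, add_zero]
    rw [hn, Real.log_sqrt (by positivity)]
  · rw [Complex.log_im, Complex.arg_of_re_nonneg (by simp), hn, Real.arctan_eq_arcsin]
    simp

theorem hasDerivAt_one_add_mul_I (u : ℝ) :
    HasDerivAt (fun u : ℝ => 1 + (u : ℂ) * Complex.I) Complex.I u := by
  simpa using ((hasDerivAt_id u).ofReal_comp.mul_const Complex.I).const_add 1

theorem hasDerivAt_log_one_add_mul_I (u : ℝ) :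
    HasDerivAt (fun u : ℝ => Complex.log (1 + (u : ℂ) * Complex.I))
      (Complex.I / (1 + (u : ℂ) * Complex.I)) u :=
  (hasDerivAt_one_add_mul_I u).clog_real (one_add_mul_I_mem_slitPlane u)

theorem continuous_log_one_add_mul_I :
    Continuous fun u : ℝ => Complex.log (1 + (u : ℂ) * Complex.I) :=
  continuous_iff_continuousAt.2 fun u => (hasDerivAt_log_one_add_mul_I u).continuousAt

/-- At u = 0 the factor log(1+iu) = O(u) absorbs the singularity of log u, and the convention log 0
= 0 gives the right value. -/
theorem continuous_log_one_add_mul_I_mul_log :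
    Continuous fun u : ℝ => Complex.log (1 + (u : ℂ) * Complex.I) * (Real.log u : ℂ) := by
  rw [continuous_iff_continuousAt]
  intro u
  rcases eq_or_ne u 0 with rfl | hu
  · have hlim : Tendsto (fun u : ℝ => 3 / 2 * |u * Real.log u|) (𝓝 0) (𝓝 0) := by
      have := (Real.continuous_mul_log.abs.const_mul (3 / 2)).tendsto 0
      simpa using this
    rw [ContinuousAt]
    simp only [Real.log_zero, Complex.ofReal_zero, mul_zero]
    refine squeeze_zero_norm' ?_ hlim
    filter_upwards [Metric.closedBall_mem_nhds (0 : ℝ) (by norm_num : (0 : ℝ) < 1 / 2)] with v hv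
    have hv' : ‖(v : ℂ) * Complex.I‖ = |v| := by simp
    have hle : ‖(v : ℂ) * Complex.I‖ ≤ 1 / 2 := by
      rw [hv']
      simpa using hv
    have := Complex.norm_log_one_add_half_le_self hle
    rw [norm_mul, Complex.norm_real, Real.norm_eq_abs, abs_mul, ← mul_assoc, ← hv']
    gcongr
  · refine continuous_log_one_add_mul_I.continuousAt.mul ?_
    exact Complex.continuous_ofReal.continuousAt.comp (Real.continuousAt_log hu)

/-- The value of `log (-iu)` for `u > 0`. -/
noncomputable def logNegIMul (u : ℝ) : ℂ := (Real.log u : ℂ) - π / 2 * Complex.I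

theorem log_neg_I_mul {u : ℝ} (hu : 0 < u) :
    Complex.log (1 - (1 + (u : ℂ) * Complex.I)) = logNegIMul u := by
  rw [show 1 - (1 + (u : ℂ) * Complex.I) = u * -Complex.I by ring,
    Complex.log_ofReal_mul hu (by simp), Complex.log_neg_I, logNegIMul]
  ring

theorem hasDerivAt_logNegIMul {u : ℝ} (hu : 0 < u) : HasDerivAt logNegIMul (1 / (u : ℂ)) u := by
  have := (Real.hasDerivAt_log hu.ne').ofReal_comp.sub_const ((π : ℂ) / 2 * Complex.I)
  refine this.congr_deriv ?_
  push_cast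
  rw [one_div]

theorem continuous_log_mul_logNegIMul :
    Continuous fun u : ℝ => Complex.log (1 + (u : ℂ) * Complex.I) * logNegIMul u := by
  simp only [logNegIMul, mul_sub]
  exact continuous_log_one_add_mul_I_mul_log.sub
    (continuous_log_one_add_mul_I.mul continuous_const)

theorem one_add_mul_I_ne_one {u : ℝ} (hu : 0 < u) : 1 + (u : ℂ) * Complex.I ≠ 1 := by
  simp [hu.ne']

theorem one_add_mul_I_ne_zero (u : ℝ) : 1 + (u : ℂ) * Complex.I ≠ 0 :=
  Complex.slitPlane_ne_zero (one_add_mul_I_mem_slitPlane u)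

theorem continuous_dilog_one_add_mul_I :
    Continuous fun u : ℝ => dilog (1 + (u : ℂ) * Complex.I) :=
  continuousOn_dilog.comp_continuous (by fun_prop) fun u => by simp

theorem continuous_trilog_one_add_mul_I :
    Continuous fun u : ℝ => trilog (1 + (u : ℂ) * Complex.I) :=
  continuousOn_trilog.comp_continuous (by fun_prop) fun u => by simp

theorem hasDerivAt_dilog_one_add_mul_I {u : ℝ} (hu : 0 < u) :
    HasDerivAt (fun u : ℝ => dilog (1 + (u : ℂ) * Complex.I))
      (-logNegIMul u / (1 + (u : ℂ) * Complex.I) * Complex.I) u := by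
  have h := hasDerivAt_dilog (z := 1 + (u : ℂ) * Complex.I) (by simp) (one_add_mul_I_ne_one hu)
    (one_add_mul_I_ne_zero u)
  rw [log_neg_I_mul hu] at h
  exact h.comp u (hasDerivAt_one_add_mul_I u)

theorem hasDerivAt_trilog_one_add_mul_I {u : ℝ} (hu : 0 < u) :
    HasDerivAt (fun u : ℝ => trilog (1 + (u : ℂ) * Complex.I))
      (dilog (1 + (u : ℂ) * Complex.I) / (1 + (u : ℂ) * Complex.I) * Complex.I) u := by
  have h := hasDerivAt_trilog (z := 1 + (u : ℂ) * Complex.I) (by simp) (one_add_mul_I_ne_one hu)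
    (one_add_mul_I_ne_zero u)
  exact h.comp u (hasDerivAt_one_add_mul_I u)

/-- Reflection formula Li₂(p) + log p · log(1-p) + Li₂(1-p) = π²/6 along p = 1+iu: the left side `R`
has zero derivative, and comparing u = 0 with u = 1 reduces the value to Li₂(-i). -/
theorem dilog_one_add_I :
    dilog (1 + Complex.I) = ((π ^ 2 / 16 : ℝ) : ℂ)
      + ((catalanG + π * Real.log 2 / 4 : ℝ) : ℂ) * Complex.I := by
  set R : ℝ → ℂ := fun u => dilog (1 + (u : ℂ) * Complex.I)
    + Complex.log (1 + (u : ℂ) * Complex.I) * logNegIMul u + dilog ((u : ℂ) * -Complex.I) with hR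
  have hcont : Continuous R := (continuous_dilog_one_add_mul_I.add
    continuous_log_mul_logNegIMul).add
    (continuousOn_dilog.comp_continuous (by fun_prop) fun u => by simp)
  have hderiv : ∀ u ∈ Set.Ioo (0 : ℝ) 1, HasDerivAt R 0 u := by
    intro u hu
    have hu0 : (u : ℂ) ≠ 0 := by exact_mod_cast hu.1.ne'
    have h3 := (hasDerivAt_dilog (z := (u : ℂ) * -Complex.I) (by simp)
      (fun h => by simpa using congrArg Complex.re h) (by simp [hu0])).comp u
      ((hasDerivAt_id u).ofReal_comp.mul_const (-Complex.I))
    have := ((hasDerivAt_dilog_one_add_mul_I hu.1).add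
      ((hasDerivAt_log_one_add_mul_I u).mul (hasDerivAt_logNegIMul hu.1))).add h3
    refine this.congr_deriv ?_
    have h1 := one_add_mul_I_ne_zero u
    have h4 := Complex.I_ne_zero
    rw [show 1 - (u : ℂ) * -Complex.I = 1 + u * Complex.I by ring]
    field_simp
    push_cast
    ring
  have h := intervalIntegral.integral_eq_sub_of_hasDerivAt_of_le zero_le_one hcont.continuousOn
    hderiv (by simp)
  rw [intervalIntegral.integral_zero] at h
  have h0 : R 0 = π ^ 2 / 6 := by simp [hR, dilog_zero, dilog_one]
  have h1 : R 1 = dilog (1 + Complex.I) + Complex.log (1 + ((1 : ℝ) : ℂ) * Complex.I)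
      * logNegIMul 1 + dilog (-Complex.I) := by simp [hR]
  rw [h0, h1, log_one_add_mul_I, Real.arctan_one, logNegIMul, Real.log_one, dilog_neg_I] at h
  have hI := Complex.I_sq
  have hlog : Complex.log 2 = (Real.log 2 : ℂ) := by simp
  norm_num at h
  rw [hlog] at h
  push_cast
  linear_combination -h + ((π : ℂ) ^ 2 / 8) * hI

/-! ### The base case S(0) -/

/-- A primitive of `Li₂(-u²) / (1 + u²)` on `[0, 1]`. -/
noncomputable def dilogPrimitive (u : ℝ) : ℝ :=
  Real.arctan u * (dilog (-(u : ℂ) ^ 2)).re +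
    2 * (Complex.log (1 + (u : ℂ) * Complex.I) *
        (Complex.log (1 + (u : ℂ) * Complex.I) * logNegIMul u)
      + 2 * (Complex.log (1 + (u : ℂ) * Complex.I) * dilog (1 + (u : ℂ) * Complex.I))
      - 2 * trilog (1 + (u : ℂ) * Complex.I)).im

theorem neg_sq_re_le (u : ℝ) : (-(u : ℂ) ^ 2).re ≤ 1 := by
  rw [← Complex.ofReal_pow, ← Complex.ofReal_neg, Complex.ofReal_re]
  nlinarith [sq_nonneg u]

theorem continuous_dilog_neg_sq : Continuous fun u : ℝ => (dilog (-(u : ℂ) ^ 2)).re :=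
  Complex.continuous_re.comp
    (continuousOn_dilog.comp_continuous (by fun_prop) neg_sq_re_le)

theorem continuous_dilogPrimitive : Continuous dilogPrimitive := by
  refine (Real.continuous_arctan.mul continuous_dilog_neg_sq).add
    (continuous_const.mul (Complex.continuous_im.comp ?_))
  exact ((continuous_log_one_add_mul_I.mul continuous_log_mul_logNegIMul).add
    (continuous_const.mul (continuous_log_one_add_mul_I.mul continuous_dilog_one_add_mul_I))).sub
    (continuous_const.mul continuous_trilog_one_add_mul_I)

theorem hasDerivAt_dilog_neg_sq {u : ℝ} (hu : 0 < u) :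
    HasDerivAt (fun u : ℝ => (dilog (-(u : ℂ) ^ 2)).re) (-2 * Real.log (1 + u ^ 2) / u) u := by
  have hu0 : (u : ℂ) ≠ 0 := by exact_mod_cast hu.ne'
  have hne : -(u : ℂ) ^ 2 ≠ 1 := by
    rw [← Complex.ofReal_pow, ← Complex.ofReal_neg, ← Complex.ofReal_one, Ne, Complex.ofReal_inj]
    nlinarith [sq_nonneg u]
  have h := (hasDerivAt_dilog (neg_sq_re_le u) hne (by simp [hu0])).comp u
    ((hasDerivAt_id u).ofReal_comp.pow 2).neg
  have h2 := Complex.reCLM.hasFDerivAt.comp_hasDerivAt u h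
  refine HasDerivAt.congr_deriv (f := fun u : ℝ => (dilog (-(u : ℂ) ^ 2)).re) h2 ?_
  have hlog : Complex.log (1 - -(u : ℂ) ^ 2) = (Real.log (1 + u ^ 2) : ℂ) := by
    rw [Complex.ofReal_log (by positivity)]
    push_cast
    ring_nf
  have : -Complex.log (1 - -(u : ℂ) ^ 2) / -(u : ℂ) ^ 2 * -(2 * (u : ℂ)) =
      ((-2 * Real.log (1 + u ^ 2) / u : ℝ) : ℂ) := by
    rw [hlog]
    push_cast
    field_simp
  simp only [id, Nat.cast_ofNat, Nat.add_one_sub_one, pow_one, mul_one, Complex.reCLM_apply,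
    Complex.ofReal_one]
  rw [this, Complex.ofReal_re]

theorem hasDerivAt_dilogPrimitive {u : ℝ} (hu : 0 < u) :
    HasDerivAt dilogPrimitive ((dilog (-(u : ℂ) ^ 2)).re / (1 + u ^ 2)) u := by
  have hu0 : (u : ℂ) ≠ 0 := by exact_mod_cast hu.ne'
  have hp := hasDerivAt_log_one_add_mul_I u
  -- With p = 1+iu, the function log²p · log(1-p) + 2 log p · Li₂(p) - 2 Li₃(p) is a primitive of
  -- log²p/u.
  have hH : HasDerivAt (fun u : ℝ => Complex.log (1 + (u : ℂ) * Complex.I) *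
        (Complex.log (1 + (u : ℂ) * Complex.I) * logNegIMul u)
      + 2 * (Complex.log (1 + (u : ℂ) * Complex.I) * dilog (1 + (u : ℂ) * Complex.I))
      - 2 * trilog (1 + (u : ℂ) * Complex.I))
      (Complex.log (1 + (u : ℂ) * Complex.I) ^ 2 / u) u := by
    refine (((hp.mul (hp.mul (hasDerivAt_logNegIMul hu))).add
      ((hp.mul (hasDerivAt_dilog_one_add_mul_I hu)).const_mul 2)).sub
      ((hasDerivAt_trilog_one_add_mul_I hu).const_mul 2)).congr_deriv ?_
    have h1 := one_add_mul_I_ne_zero u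
    simp only [Pi.mul_apply]
    field_simp
    ring
  have him := Complex.imCLM.hasFDerivAt.comp_hasDerivAt u hH
  have := ((Real.hasDerivAt_arctan u).mul (hasDerivAt_dilog_neg_sq hu)).add (him.const_mul 2)
  refine HasDerivAt.congr_deriv (f := dilogPrimitive) this ?_
  -- Twice the imaginary part cancels arctan u times the derivative of Li₂(-u²).
  have hsq : Complex.log (1 + (u : ℂ) * Complex.I) ^ 2 / u =
      (((Real.log (1 + u ^ 2) ^ 2 / 4 - Real.arctan u ^ 2) / u : ℝ) : ℂ)
        + ((Real.log (1 + u ^ 2) * Real.arctan u / u : ℝ) : ℂ) * Complex.I := by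
    rw [log_one_add_mul_I]
    push_cast [-Complex.ofReal_arctan]
    field_simp
    linear_combination 16 * ((Real.arctan u : ℂ) ^ 2) * Complex.I_sq
  rw [Complex.imCLM_apply, hsq]
  simp only [Complex.add_im, Complex.ofReal_im, Complex.mul_im, Complex.ofReal_re, Complex.I_im,
    mul_one, Complex.I_re, mul_zero, add_zero, zero_add]
  ring

theorem integral_dilog_neg_sq :
    ∫ u in (0 : ℝ)..1, (dilog (-(u : ℂ) ^ 2)).re / (1 + u ^ 2) =
      π / 4 * Real.log 2 ^ 2 + 5 * π ^ 3 / 48 + 2 * catalanG * Real.log 2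
        - 4 * (trilog (1 + Complex.I)).im := by
  have hc : Continuous fun u : ℝ => (dilog (-(u : ℂ) ^ 2)).re / (1 + u ^ 2) :=
    continuous_dilog_neg_sq.div (by fun_prop) fun u => by positivity
  rw [intervalIntegral.integral_eq_sub_of_hasDerivAt_of_le zero_le_one
    continuous_dilogPrimitive.continuousOn (fun u hu => hasDerivAt_dilogPrimitive hu.1)
    (hc.intervalIntegrable _ _)]
  have htri : (trilog 1).im = 0 := by
    have h := Complex.hasSum_im (hasSum_trilog (z := 1) (by simp))
    refine h.unique (hasSum_zero.congr_fun fun k => ?_)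
    have : (1 : ℂ) ^ (k + 1) / ((k : ℂ) + 1) ^ 3 = ((1 / ((k : ℝ) + 1) ^ 3 : ℝ) : ℂ) := by
      push_cast
      simp
    rw [this, Complex.ofReal_im]
  -- Here p = 1, so log p = 0 and only Li₃(1) survives, which is real.
  have h0 : dilogPrimitive 0 = 0 := by simp [dilogPrimitive, htri]
  have h1 : dilogPrimitive 1 = π / 4 * (-(π ^ 2 / 12))
      + 2 * ((((Real.log 2 / 2 : ℝ) : ℂ) + ((π / 4 : ℝ) : ℂ) * Complex.I) *
        ((((Real.log 2 / 2 : ℝ) : ℂ) + ((π / 4 : ℝ) : ℂ) * Complex.I) *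
          (((-(π / 2) : ℝ) : ℂ) * Complex.I))
      + 2 * ((((Real.log 2 / 2 : ℝ) : ℂ) + ((π / 4 : ℝ) : ℂ) * Complex.I) *
        (((π ^ 2 / 16 : ℝ) : ℂ) + ((catalanG + π * Real.log 2 / 4 : ℝ) : ℂ) * Complex.I))
      - 2 * trilog (1 + Complex.I)).im := by
    have e1 : (dilog (-((1 : ℝ) : ℂ) ^ 2)).re = -(π ^ 2 / 12) := by
      rw [Complex.ofReal_one, one_pow, dilog_neg_one]
      have : (-((π : ℂ) ^ 2 / 12)) = ((-(π ^ 2 / 12) : ℝ) : ℂ) := by push_cast; rfl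
      rw [this, Complex.ofReal_re]
    have e2 : logNegIMul 1 = ((-(π / 2) : ℝ) : ℂ) * Complex.I := by
      simp [logNegIMul]
    have e3 := log_one_add_mul_I 1
    rw [Real.arctan_one, one_pow, one_add_one_eq_two] at e3
    rw [dilogPrimitive, e1, e2, e3, Real.arctan_one, Complex.ofReal_one, one_mul, dilog_one_add_I]
  rw [h0, h1]
  simp only [Complex.add_im, Complex.sub_im, Complex.mul_im, Complex.mul_re, Complex.add_re,
    Complex.ofReal_re, Complex.ofReal_im, Complex.I_re, Complex.I_im, Complex.re_ofNat,
    Complex.im_ofNat]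
  ring

/-- Expand Li₂(-u²) in powers of u² and integrate termwise, with 1/(k+1)² as dominating series. -/
theorem hasSum_cauchyMoment :
    HasSum (fun k : ℕ => (-1 : ℝ) ^ (k + 1) * cauchyMoment (2 * (k + 1)) / ((k : ℝ) + 1) ^ 2)
      (π / 4 * Real.log 2 ^ 2 + 5 * π ^ 3 / 48 + 2 * catalanG * Real.log 2
        - 4 * (trilog (1 + Complex.I)).im) := by
  rw [← integral_dilog_neg_sq]
  have h := intervalIntegral.hasSum_integral_of_dominated_convergence (μ := volume)
    (a := 0) (b := 1)
    (F := fun (k : ℕ) (u : ℝ) => (-1) ^ (k + 1) / ((k : ℝ) + 1) ^ 2 *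
      (u ^ (2 * (k + 1)) / (1 + u ^ 2)))
    (f := fun u : ℝ => (dilog (-(u : ℂ) ^ 2)).re / (1 + u ^ 2))
    (bound := fun k _ => 1 / ((k : ℝ) + 1) ^ 2)
    (fun k => Measurable.aestronglyMeasurable (by fun_prop))
    (fun k => Eventually.of_forall fun u hu => ?_)
    (Eventually.of_forall fun u _ => hasSum_one_div_succ_sq.summable) (by simp)
    (Eventually.of_forall fun u hu => ?_)
  · refine h.congr_fun fun k => ?_
    rw [intervalIntegral.integral_const_mul, cauchyMoment]
    ring
  · rw [Set.uIoc_of_le zero_le_one] at hu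
    rw [norm_mul, norm_div, norm_pow, norm_neg, norm_one, one_pow, Real.norm_of_nonneg
      (by positivity), Real.norm_of_nonneg (div_nonneg (pow_nonneg hu.1.le _) (by positivity))]
    refine mul_le_of_le_one_right (by positivity) ((div_le_one (by positivity)).2 ?_)
    exact (pow_le_one₀ hu.1.le hu.2).trans (by nlinarith [sq_nonneg u])
  · rw [Set.uIoc_of_le zero_le_one] at hu
    have hn : ‖-(u : ℂ) ^ 2‖ ≤ 1 := by
      rw [norm_neg, norm_pow, Complex.norm_real, Real.norm_of_nonneg hu.1.le]
      exact pow_le_one₀ hu.1.le hu.2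
    refine ((Complex.hasSum_re (hasSum_dilog hn)).div_const (1 + u ^ 2)).congr_fun fun k => ?_
    have : (-(u : ℂ) ^ 2) ^ (k + 1) / ((k : ℂ) + 1) ^ 2 =
        (((-1) ^ (k + 1) * u ^ (2 * (k + 1)) / ((k : ℝ) + 1) ^ 2 : ℝ) : ℂ) := by
      push_cast
      rw [neg_pow, pow_mul]
    rw [this, Complex.ofReal_re]
    ring

/-! ### Recursion in n and the closed forms -/

theorem hasSum_digammaDiff_of_moment {n : ℕ} {a : ℝ}
    (h : HasSum (fun k : ℕ => (-1 : ℝ) ^ (k + 1) * cauchyMoment (2 * (k + 1 + (n + 1)))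
      / ((k : ℝ) + 1) ^ 2) a) :
    HasSum (fun k : ℕ => (-1 : ℂ) ^ (k + 1) * digammaDiff (k + 1) n / (2 * ((k : ℂ) + 1)) ^ 2)
      (a : ℂ) := by
  refine (Complex.hasSum_ofReal.2 h).congr_fun fun k => ?_
  have : (k : ℂ) + 1 ≠ 0 := by exact_mod_cast k.succ_ne_zero
  rw [digammaDiff_eq_ofReal, realDigammaDiff_eq,
    show 2 * (k + 1 + n) + 2 = 2 * (k + 1 + (n + 1)) by ring]
  push_cast
  field_simp
  ring

theorem hasSum_moment_succ {m : ℕ} {a : ℝ}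
    (h : HasSum (fun k : ℕ => (-1 : ℝ) ^ (k + 1) * cauchyMoment (2 * (k + 1 + m))
      / ((k : ℝ) + 1) ^ 2) a) :
    HasSum (fun k : ℕ => (-1 : ℝ) ^ (k + 1) * cauchyMoment (2 * (k + 1 + (m + 1)))
      / ((k : ℝ) + 1) ^ 2)
      (-(π ^ 2 / (12 * (2 * (m : ℝ) + 1))) + 2 * Real.log 2 / (2 * (m : ℝ) + 1) ^ 2
        - 4 / (2 * (m : ℝ) + 1) ^ 2 * cauchyMoment (2 * (m + 1)) - a) := by
  have h1 := (hasSum_alternating_sq_mul_linear (c := 2 * m + 1) (by omega)).sub h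
  rw [show 2 * m + 1 + 1 = 2 * (m + 1) by ring] at h1
  push_cast at h1
  refine h1.congr_fun fun k => ?_
  have h2 := cauchyMoment_add (2 * (k + 1 + m))
  rw [show 2 * (k + 1 + m) + 2 = 2 * (k + 1 + (m + 1)) by ring] at h2
  push_cast at h2
  rw [show 2 * ((k : ℝ) + 1) + (2 * m + 1) = 2 * (k + 1 + m) + 1 by ring, ← h2]
  ring

theorem hasSum_moment_even (i : ℕ) :
    HasSum (fun k : ℕ => (-1 : ℝ) ^ (k + 1) * cauchyMoment (2 * (k + 1 + (2 * i + 1)))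
      / ((k : ℝ) + 1) ^ 2)
        (-4
          - 8 * ∑ k ∈ Finset.range i, ∑ j ∈ Finset.Icc 0 (2 * k + 1),
              (-1 : ℝ) ^ j * (16 * (k : ℝ) ^ 2 + 32 * (k : ℝ) + 17)
                / ((2 * (j : ℝ) + 1) * (4 * (k : ℝ) + 5) ^ 2 * (4 * (k : ℝ) + 3) ^ 2)
          - 4 * ∑ j ∈ Finset.range i, 1 / (4 * (j : ℝ) + 5) ^ 3
          + (1
              + ∑ j ∈ Finset.range i,
                  2 * (16 * (j : ℝ) ^ 2 + 32 * (j : ℝ) + 17)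
                    / ((4 * (j : ℝ) + 5) ^ 2 * (4 * (j : ℝ) + 3) ^ 2)
              - 1 / 4 * Real.log 2 ^ 2) * π
          + (1
              - 16 * ∑ j ∈ Finset.range i,
                  ((j : ℝ) + 1) / ((4 * (j : ℝ) + 5) ^ 2 * (4 * (j : ℝ) + 3) ^ 2))
            * (2 * Real.log 2)
          + (-(1 / 2)
              + ∑ j ∈ Finset.range i,
                  1 / ((4 * (j : ℝ) + 5) * (4 * (j : ℝ) + 3))) * (π ^ 2 / 6)
          - 5 * π ^ 3 / 48 - 2 * catalanG * Real.log 2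
          + 4 * (trilog (1 + Complex.I)).im) := by
  induction i with
  | zero =>
    have h := hasSum_moment_succ (m := 0) hasSum_cauchyMoment
    rw [cauchyMoment_even] at h
    convert h using 1
    norm_num
    ring
  | succ i ih =>
    have h := hasSum_moment_succ (hasSum_moment_succ ih)
    rw [show 2 * i + 1 + 1 + 1 = 2 * (i + 1) + 1 by ring] at h
    convert h using 1
    rw [cauchyMoment_even, cauchyMoment_even, show 2 * i + 1 + 1 = 2 * (i + 1) by ring,
      -- The second moment has one Leibniz term more than the first, namely 1/(4i+5); it yields the
      -- cubic sum.
      Finset.sum_range_succ _ (2 * (i + 1))]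
    simp only [Finset.sum_range_succ _ i]
    have hS : ∑ j ∈ Finset.Icc 0 (2 * i + 1),
        (-1 : ℝ) ^ j * (16 * (i : ℝ) ^ 2 + 32 * (i : ℝ) + 17)
          / ((2 * (j : ℝ) + 1) * (4 * (i : ℝ) + 5) ^ 2 * (4 * (i : ℝ) + 3) ^ 2) =
        (16 * (i : ℝ) ^ 2 + 32 * (i : ℝ) + 17) / ((4 * (i : ℝ) + 5) ^ 2 * (4 * (i : ℝ) + 3) ^ 2)
          * ∑ j ∈ Finset.range (2 * (i + 1)), (-1 : ℝ) ^ j / (2 * (j : ℝ) + 1) := by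
      rw [Finset.mul_sum, ← Nat.range_succ_eq_Icc_zero]
      refine Finset.sum_congr rfl fun j _ => ?_
      field_simp
    rw [hS]
    have he : (-1 : ℝ) ^ (2 * (i + 1)) = 1 := Even.neg_one_pow ⟨i + 1, by ring⟩
    have he' : (-1 : ℝ) ^ (2 * (i + 1) + 1) = -1 := Odd.neg_one_pow ⟨_, rfl⟩
    rw [he, he']
    -- Both sides are affine in the Leibniz sum, so it can be an indeterminate. Its coefficient
    -- comes from 4/(4i+3)² + 4/(4i+5)² = 8(16i²+32i+17)/((4i+3)²(4i+5)²).
    generalize ∑ j ∈ Finset.range (2 * (i + 1)), (-1 : ℝ) ^ j / (2 * (j : ℝ) + 1) = S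
    push_cast
    have h5 : (4 * (i : ℝ) + 5) ≠ 0 := by positivity
    have h3 : (4 * (i : ℝ) + 3) ≠ 0 := by positivity
    rw [show 2 * (2 * (i : ℝ) + 1) + 1 = 4 * i + 3 by ring,
      show 2 * (2 * ((i : ℝ) + 1)) + 1 = 4 * i + 5 by ring]
    rw [← sub_eq_zero]
    ring_nf
    field_simp
    ring

theorem hasSum_moment_odd (i : ℕ) :
    HasSum (fun k : ℕ => (-1 : ℝ) ^ (k + 1) * cauchyMoment (2 * (k + 1 + (2 * i + 2)))
      / ((k : ℝ) + 1) ^ 2)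
        (116 / 27
          + 8 * ∑ k ∈ Finset.Icc 1 i, ∑ j ∈ Finset.Icc 0 (2 * k),
              (-1 : ℝ) ^ j * (16 * (k : ℝ) ^ 2 + 16 * (k : ℝ) + 5)
                / ((2 * (j : ℝ) + 1) * (4 * (k : ℝ) + 3) ^ 2 * (4 * (k : ℝ) + 1) ^ 2)
          - 4 * ∑ j ∈ Finset.Icc 1 i, 1 / (4 * (j : ℝ) + 3) ^ 3
          + (-(10 / 9)
              - ∑ j ∈ Finset.Icc 1 i,
                  2 * (16 * (j : ℝ) ^ 2 + 16 * (j : ℝ) + 5)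
                    / ((4 * (j : ℝ) + 3) ^ 2 * (4 * (j : ℝ) + 1) ^ 2)
              + 1 / 4 * Real.log 2 ^ 2) * π
          - (1 / 9
              + ∑ j ∈ Finset.Icc 1 i,
                  (2 * (j : ℝ) + 1) / ((4 * (j : ℝ) + 3) ^ 2 * (4 * (j : ℝ) + 1) ^ 2))
            * (16 * Real.log 2)
          + (1 / 18
              + 1 / 6 * ∑ j ∈ Finset.Icc 1 i,
                  1 / ((4 * (j : ℝ) + 3) * (4 * (j : ℝ) + 1))) * π ^ 2
          + 5 * π ^ 3 / 48 + 2 * catalanG * Real.log 2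
          - 4 * (trilog (1 + Complex.I)).im) := by
  induction i with
  | zero =>
    -- The odd chain starts at S(2), one recursion step after the even chain's S(1).
    have h := hasSum_moment_succ (hasSum_moment_even 0)
    rw [cauchyMoment_even] at h
    convert h using 1
    norm_num [Finset.sum_range_succ]
    ring
  | succ i ih =>
    have h := hasSum_moment_succ (hasSum_moment_succ ih)
    rw [show 2 * i + 2 + 1 + 1 = 2 * (i + 1) + 2 by ring] at h
    convert h using 1
    rw [cauchyMoment_even, cauchyMoment_even, show 2 * i + 2 + 1 = 2 * (i + 1) + 1 by ring,
      Finset.sum_range_succ _ (2 * (i + 1) + 1)]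
    simp only [Finset.sum_Icc_succ_top (Nat.le_add_left 1 i)]
    have hS : ∑ j ∈ Finset.Icc 0 (2 * (i + 1)),
        (-1 : ℝ) ^ j * (16 * ((i + 1 : ℕ) : ℝ) ^ 2 + 16 * ((i + 1 : ℕ) : ℝ) + 5)
          / ((2 * (j : ℝ) + 1) * (4 * ((i + 1 : ℕ) : ℝ) + 3) ^ 2
            * (4 * ((i + 1 : ℕ) : ℝ) + 1) ^ 2) =
        (16 * ((i + 1 : ℕ) : ℝ) ^ 2 + 16 * ((i + 1 : ℕ) : ℝ) + 5)
          / ((4 * ((i + 1 : ℕ) : ℝ) + 3) ^ 2 * (4 * ((i + 1 : ℕ) : ℝ) + 1) ^ 2)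
          * ∑ j ∈ Finset.range (2 * (i + 1) + 1), (-1 : ℝ) ^ j / (2 * (j : ℝ) + 1) := by
      rw [Finset.mul_sum, ← Nat.range_succ_eq_Icc_zero]
      refine Finset.sum_congr rfl fun j _ => ?_
      field_simp
    rw [hS]
    have he : (-1 : ℝ) ^ (2 * (i + 1) + 2) = 1 := Even.neg_one_pow ⟨i + 2, by ring⟩
    have he' : (-1 : ℝ) ^ (2 * (i + 1) + 1) = -1 := Odd.neg_one_pow ⟨_, rfl⟩
    rw [show 2 * (i + 1) + 1 + 1 = 2 * (i + 1) + 2 by ring, he, he']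
    generalize ∑ j ∈ Finset.range (2 * (i + 1) + 1), (-1 : ℝ) ^ j / (2 * (j : ℝ) + 1) = S
    push_cast
    have h7 : (4 * (i : ℝ) + 7) ≠ 0 := by positivity
    have h5 : (4 * (i : ℝ) + 5) ≠ 0 := by positivity
    rw [show 2 * (2 * (i : ℝ) + 2) + 1 = 4 * i + 5 by ring,
      show 2 * (2 * ((i : ℝ) + 1) + 1) + 1 = 4 * i + 7 by ring,
      show 4 * ((i : ℝ) + 1) + 3 = 4 * i + 7 by ring,
      show 4 * ((i : ℝ) + 1) + 1 = 4 * i + 5 by ring]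
    rw [← sub_eq_zero]
    ring_nf
    field_simp
    ring

theorem theorem8 (n : ℕ) :
    (n = 0 →
      HasSum (fun k : ℕ => (-1 : ℂ) ^ (k + 1) * digammaDiff (k + 1) n / (2 * ((k : ℂ) + 1)) ^ 2)
        ((-4 + π + 2 * Real.log 2 - π / 4 * Real.log 2 ^ 2 - π ^ 2 / 12 - 5 * π ^ 3 / 48
          - 2 * catalanG * Real.log 2 + 4 * (trilog (1 + Complex.I)).im : ℝ) : ℂ)) ∧
    (n = 1 →
      HasSum (fun k : ℕ => (-1 : ℂ) ^ (k + 1) * digammaDiff (k + 1) n / (2 * ((k : ℂ) + 1)) ^ 2)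
        ((116 / 27 - 10 * π / 9 - 16 * Real.log 2 / 9 + π / 4 * Real.log 2 ^ 2 + π ^ 2 / 18
          + 5 * π ^ 3 / 48 + 2 * catalanG * Real.log 2
          - 4 * (trilog (1 + Complex.I)).im : ℝ) : ℂ)) ∧
    (Odd n → n ≠ 1 →
      HasSum (fun k : ℕ => (-1 : ℂ) ^ (k + 1) * digammaDiff (k + 1) n / (2 * ((k : ℂ) + 1)) ^ 2)
        ((116 / 27
          + 8 * ∑ k ∈ Finset.Icc 1 ((n - 1) / 2), ∑ j ∈ Finset.Icc 0 (2 * k),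
              (-1 : ℝ) ^ j * (16 * (k : ℝ) ^ 2 + 16 * (k : ℝ) + 5)
                / ((2 * (j : ℝ) + 1) * (4 * (k : ℝ) + 3) ^ 2 * (4 * (k : ℝ) + 1) ^ 2)
          - 4 * ∑ j ∈ Finset.Icc 1 ((n - 1) / 2), 1 / (4 * (j : ℝ) + 3) ^ 3
          + (-(10 / 9)
              - ∑ j ∈ Finset.Icc 1 ((n - 1) / 2),
                  2 * (16 * (j : ℝ) ^ 2 + 16 * (j : ℝ) + 5)
                    / ((4 * (j : ℝ) + 3) ^ 2 * (4 * (j : ℝ) + 1) ^ 2)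
              + 1 / 4 * Real.log 2 ^ 2) * π
          - (1 / 9
              + ∑ j ∈ Finset.Icc 1 ((n - 1) / 2),
                  (2 * (j : ℝ) + 1) / ((4 * (j : ℝ) + 3) ^ 2 * (4 * (j : ℝ) + 1) ^ 2))
            * (16 * Real.log 2)
          + (1 / 18
              + 1 / 6 * ∑ j ∈ Finset.Icc 1 ((n - 1) / 2),
                  1 / ((4 * (j : ℝ) + 3) * (4 * (j : ℝ) + 1))) * π ^ 2
          + 5 * π ^ 3 / 48 + 2 * catalanG * Real.log 2
          - 4 * (trilog (1 + Complex.I)).im : ℝ) : ℂ)) ∧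
    -- for even `n` the sums run over `0 ≤ j ≤ (n - 2) / 2`, that is, `j < n / 2`
    (Even n →
      HasSum (fun k : ℕ => (-1 : ℂ) ^ (k + 1) * digammaDiff (k + 1) n / (2 * ((k : ℂ) + 1)) ^ 2)
        ((-4
          - 8 * ∑ k ∈ Finset.range (n / 2), ∑ j ∈ Finset.Icc 0 (2 * k + 1),
              (-1 : ℝ) ^ j * (16 * (k : ℝ) ^ 2 + 32 * (k : ℝ) + 17)
                / ((2 * (j : ℝ) + 1) * (4 * (k : ℝ) + 5) ^ 2 * (4 * (k : ℝ) + 3) ^ 2)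
          - 4 * ∑ j ∈ Finset.range (n / 2), 1 / (4 * (j : ℝ) + 5) ^ 3
          + (1
              + ∑ j ∈ Finset.range (n / 2),
                  2 * (16 * (j : ℝ) ^ 2 + 32 * (j : ℝ) + 17)
                    / ((4 * (j : ℝ) + 5) ^ 2 * (4 * (j : ℝ) + 3) ^ 2)
              - 1 / 4 * Real.log 2 ^ 2) * π
          + (1
              - 16 * ∑ j ∈ Finset.range (n / 2),
                  ((j : ℝ) + 1) / ((4 * (j : ℝ) + 5) ^ 2 * (4 * (j : ℝ) + 3) ^ 2))
            * (2 * Real.log 2)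
          + (-(1 / 2)
              + ∑ j ∈ Finset.range (n / 2),
                  1 / ((4 * (j : ℝ) + 5) * (4 * (j : ℝ) + 3))) * (π ^ 2 / 6)
          - 5 * π ^ 3 / 48 - 2 * catalanG * Real.log 2
          + 4 * (trilog (1 + Complex.I)).im : ℝ) : ℂ)) := by
  have heven (i : ℕ) := hasSum_digammaDiff_of_moment (n := 2 * i) (hasSum_moment_even i)
  have hodd (i : ℕ) := hasSum_digammaDiff_of_moment (n := 2 * i + 1) (hasSum_moment_odd i)
  refine ⟨?_, ?_, ?_, ?_⟩
  · rintro rfl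
    convert heven 0 using 2
    norm_num
    ring
  · rintro rfl
    convert hodd 0 using 2
    norm_num
    ring
  · rintro ⟨i, rfl⟩ _
    rw [show (2 * i + 1 - 1) / 2 = i by omega]
    exact hodd i
  · rintro ⟨i, rfl⟩
    rw [← two_mul, show 2 * i / 2 = i by omega]
    exact heven i
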